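/- Identify $\mathbb Z^2$ with $\mathbb Z+i\mathbb Z$ and use its nearest neighbour graph. Let $A\subset\mathbb Z^2$ be finite with $0,1\in A$, and suppose that $A$ and $\mathbb Z^2\setminus A$ are both connected. Let $\partial A$ be the set of points at distance one from $A$. **Weights.** Let $p$ be the simple random walk weight: $p_{uv}=1/4$ for nearest neighbours $u,v$ at least one of which is in $A$, and $p_{uv}=0$ otherwise. Let $k$ be the smallest positive integer such that $-ki\notin A$ or $1-ki\notin A$. The edges crossing the zipper are those joining $-ji$ and $1-ji$ with $0<j<k$. Let $q$ be the zipper weight: $q_{uv}=-p_{uv}$ if the edge $uv$ crosses the zipper, and $q_{uv}=p_{uv}$ otherwise. The weight of a path is the product of the weights of its edges. **Paths.** For $B\subset A$ let $\mathcal K_B(u,v)$ be the set of nearest neighbour paths $[\omega_0,\dots,\omega_n]$ from $u$ to $v$ with $\omega_j\in B$ for $0<j<n$. For a weight $w\in\{p,q\}$ put $H^w_B(u,v)=\sum_{\omega\in\mathcal K_B(u,v)}w(\omega)$. When $u=v\in B$ write $G^w_B(u,u)$ for this sum; it includes the trivial path. Let $\mathcal W_A(u,v)\subset\mathcal K_A(u,v)$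 be the set of self-avoiding walks, and let $LE(\omega)$ be the chronological loop-erasure of $\omega$. For $\eta\in\mathcal W_A(x,y)$ put $$\hat w(\eta)=\sum_{\omega\in\mathcal K_A(x,y),\ LE(\omega)=\eta}w(\omega),$$ and for a function $X$ of paths put $\langle X;A,x,y\rangle_w=\sum_{\omega\in\mathcal K_A(x,y)}X(\omega)\,w(\omega)$. **Loops.** An unrooted loop $\ell$ in $A$ is a closed nearest neighbour path in $A$ of positive length, considered up to the choice of its starting point. Put $m_p(\ell)=\sum_{l}p(l)/|l|$, the sum being over the distinct rooted representatives $l$ of $\ell$, where $|l|$ is the length of $l$. Let $O_A$ be the set of unrooted loops in $A$ that cross the zipper an odd number of times, and $m_p(O_A)=\sum_{\ell\in O_A}m_p(\ell)$. **Positive order.** Distinct points $x,y\in\partial A$ are positively ordered if every $\eta\in\mathcal W_A(x,y)$ that uses the directed edge $\overrightarrow{01}$ crosses the zipper an even number of times, and every $\eta\in\mathcal W_A(x,y)$ that uses $\overrightarrow{10}$ crosses it an odd number of times. **Proposition.** Let $x,y\in\partial A$ be positively ordered. All the sums above converge absolutely, and the following hold. 1. For every $\eta\in\mathcal W_A(x,y)$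 that contains the directed edge $\overrightarrow{01}$, $$\hat q(\eta)=\hat p(\eta)\,\exp\{-2m_p(O_A)\}.$$ 2. Let $I_e$, $I_{\mathbf e}$, $I_{\mathbf e^R}$ be the indicators that $LE(\omega)$ uses the undirected edge $e=\{0,1\}$, the directed edge $\mathbf e=\overrightarrow{01}$, and the directed edge $\mathbf e^R=\overrightarrow{10}$, respectively. Then $$\langle I_e;A,x,y\rangle_p=\exp\{2m_p(O_A)\}\,\langle I_{\mathbf e}-I_{\mathbf e^R};A,x,y\rangle_q=\exp\{2m_p(O_A)\}\;q_{\mathbf e}\,F^q_{\mathbf e}(A)\,\Delta^q_{A'}(x,y;0,1),$$ where $A'=A\setminus\{0,1\}$, $F^q_{\mathbf e}(A)=G^q_A(0,0)\,G^q_{A\setminus\{0\}}(1,1)$ and $$\Delta^q_{A'}(x,y;0,1)=H^q_{A'}(x,0)\,H^q_{A'}(y,1)-H^q_{A'}(x,1)\,H^q_{A'}(y,0).$$ The one-step paths between $x$ or $y$ and $0$ or $1$ count in these kernels when they exist. -/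

import Mathlib

namespace LoopErased

/-- The square lattice `ℤ + iℤ`; the pair `(a, b)` is the point `a + b i`. -/
abbrev Site : Type := ℤ × ℤ

/-- Nearest neighbour graph of the square lattice. -/
def lattice : SimpleGraph Site where
  Adj u v := |u.1 - v.1| + |u.2 - v.2| = 1
  symm := ⟨fun u v h => by
    rw [abs_sub_comm v.1 u.1, abs_sub_comm v.2 u.2]; exact h⟩
  loopless := ⟨fun u h => by simp at h⟩

/-- Finite connected sets of lattice points containing `0` and `1` whose complement in the lattice
is connected as well. -/
structure IsSimplyConnectedSet (A : Finset Site) : Prop where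
  zero_mem : ((0, 0) : Site) ∈ A
  one_mem : ((1, 0) : Site) ∈ A
  connected : (lattice.induce (A : Set Site)).Connected
  compl_connected : (lattice.induce (A : Set Site)ᶜ).Connected

/-- The boundary: the lattice points at distance one from `A`. -/
def boundary (A : Finset Site) : Set Site :=
  {z | z ∉ A ∧ ∃ w ∈ A, lattice.Adj z w}

/-! ### Paths, weights and loop erasure

The path `[ω₀, ω₁, …, ωₙ]` is the list of its vertices. -/

/-- The successive directed edges `(ωⱼ₋₁, ωⱼ)` of a path. -/
def steps (ω : List Site) : List (Site × Site) := ω.zip ω.tail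

/-- The weight of a path: the product of the weights of its directed edges. -/
noncomputable def pathWeight (q : Site → Site → ℝ) (ω : List Site) : ℝ :=
  ((steps ω).map fun e => q e.1 e.2).prod

/-- Nearest neighbour paths from `x` to `y` all of whose vertices, except possibly the first and
the last one, lie in `A`. The endpoints may lie in `A` or outside. -/
def walks (A : Finset Site) (x y : Site) : Set (List Site) :=
  {ω | ω.head? = some x ∧ ω.getLast? = some y ∧ ω.IsChain lattice.Adj ∧ ∀ z ∈ ω.tail.dropLast, z ∈ A}

/-- Self-avoiding walks. -/
def saws (A : Finset Site) (x y : Site) : Set (List Site) :=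
  {η | η ∈ walks A x y ∧ η.Nodup}

/-- Chronological loop erasure: keep the first vertex `x`, skip to just after the last visit to
`x`, and continue from there. -/
def loopErase : List Site → List Site
  | [] => []
  | x :: t => x :: loopErase (t.rtakeWhile fun z => z ≠ x)
termination_by ω => ω.length
decreasing_by
  have h := (List.rtakeWhile_suffix (fun z => decide (z ≠ x)) t).length_le
  simpa using Nat.lt_succ_of_le h

open Classical in
/-- Simple random walk weight on the edges with at least one endpoint in `A`, extended by zero (so a
one-step path between two boundary points has weight zero). -/
noncomputable def srw (A : Finset Site) (u v : Site) : ℝ :=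
  if lattice.Adj u v ∧ (u ∈ A ∨ v ∈ A) then 1 / 4 else 0

/-- The edge `{u, v}` crosses the downward zipper of `A`: it is `{-ji, 1-ji}` with `0 < j < k`, where
`k` is the least positive integer such that `-ki ∉ A` or `1-ki ∉ A`. -/
def CrossesZipper (A : Finset Site) (u v : Site) : Prop :=
  ∃ j : ℕ, 0 < j ∧
    (∀ i : ℕ, 0 < i → i ≤ j → ((0, -(i : ℤ)) : Site) ∈ A ∧ ((1, -(i : ℤ)) : Site) ∈ A) ∧
    ((u = (0, -(j : ℤ)) ∧ v = (1, -(j : ℤ))) ∨ (u = (1, -(j : ℤ)) ∧ v = (0, -(j : ℤ))))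

open Classical in
/-- The zipper weight attached to simple random walk in `A`. -/
noncomputable def zipperWeight (A : Finset Site) (u v : Site) : ℝ :=
  (if CrossesZipper A u v then -1 else 1) * srw A u v

open Classical in
/-- The number of edges of a path that cross the zipper. -/
noncomputable def crossings (A : Finset Site) (ω : List Site) : ℕ :=
  (steps ω).countP fun e => CrossesZipper A e.1 e.2

/-- The ordered pair `(x, y)` of distinct points is positively ordered with respect to the zipper:
self-avoiding walks in `A` from `x` to `y` through the directed edge from `0` to `1` cross the zipper
an even number of times, those through the reversed edge an odd number of times. -/
def PositivelyOrdered (A : Finset Site) (x y : Site) : Prop :=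
  x ≠ y ∧
  (∀ η ∈ saws A x y, (((0, 0), (1, 0)) : Site × Site) ∈ steps η → Even (crossings A η)) ∧
  (∀ η ∈ saws A x y, (((1, 0), (0, 0)) : Site × Site) ∈ steps η → Odd (crossings A η))

/-! ### Total masses -/

/-- The total mass `∑ q(ω)` of the paths from `x` to `y` in `A`: the Green's function when
`x, y ∈ A`, the (boundary) Poisson kernel when endpoints lie outside `A`. -/
noncomputable def mass (q : Site → Site → ℝ) (A : Finset Site) (x y : Site) : ℝ :=
  ∑' ω : walks A x y, pathWeight q ω

/-- `⟨X; A, x, y⟩_q`. -/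
noncomputable def expect (q : Site → Site → ℝ) (A : Finset Site) (x y : Site)
    (X : List Site → ℝ) : ℝ :=
  ∑' ω : walks A x y, X ω * pathWeight q ω

/-- The loop-erased measure of `η`, a self-avoiding walk from `x` to `y`. -/
noncomputable def loopErasedMeasure (q : Site → Site → ℝ) (A : Finset Site) (x y : Site)
    (η : List Site) : ℝ :=
  ∑' ω : {ω : List Site // ω ∈ walks A x y ∧ loopErase ω = η}, pathWeight q ω

/-- `F_B(A) = ∏ⱼ G_{A ∖ {x₁, …, xⱼ₋₁}}(xⱼ, xⱼ)` for `B = {x₁, …, xₙ} ⊆ A`. -/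
noncomputable def loopFactor (q : Site → Site → ℝ) : List Site → Finset Site → ℝ
  | [], _ => 1
  | x :: B, A => mass q A x x * loopFactor q B (A.erase x)

/-- The determinant `H_A(x,z) H_A(y,w) - H_A(x,w) H_A(y,z)`. -/
noncomputable def kernelDet (q : Site → Site → ℝ) (A : Finset Site) (x y z w : Site) : ℝ :=
  mass q A x z * mass q A y w - mass q A x w * mass q A y z

/-- Indicator that the loop erasure of a path uses the directed edge `e`. -/
noncomputable def usesDirected (e : Site × Site) (ω : List Site) : ℝ :=
  if e ∈ steps (loopErase ω) then 1 else 0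

/-- Indicator that the loop erasure of a path uses the undirected edge underlying `e`. -/
noncomputable def usesUndirected (e : Site × Site) (ω : List Site) : ℝ :=
  if e ∈ steps (loopErase ω) ∨ e.swap ∈ steps (loopErase ω) then 1 else 0

/-! ### Loops

The rooted loop `[l₀, l₁, …, lₙ]`, `lₙ = l₀`, is the list `[l₀, …, lₙ₋₁]`, whose length is the
length of the loop. An unrooted loop is such a list up to rotation, that is, an element of `Cycle`. -/

/-- The closed path `[l₀, …, lₙ₋₁, l₀]`. -/
def closeUp (l : List Site) : List Site := l ++ l.take 1

/-- Nontrivial rooted nearest neighbour loops in `A`. -/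
def rootedLoops (A : Finset Site) : Set (List Site) :=
  {l | l ≠ [] ∧ (∀ z ∈ l, z ∈ A) ∧ (closeUp l).IsChain lattice.Adj}

/-- Unrooted loops in `A`. -/
def unrootedLoops (A : Finset Site) : Set (Cycle Site) :=
  (fun l : List Site => (l : Cycle Site)) '' rootedLoops A

/-- Unrooted loops in `A` that cross the zipper an odd number of times. -/
def oddLoops (A : Finset Site) : Set (Cycle Site) :=
  (fun l : List Site => (l : Cycle Site)) '' {l | l ∈ rootedLoops A ∧ Odd (crossings A (closeUp l))}

/-- The unrooted loop measure of `ℓ`: the sum of `q(l) / |l|` over the distinct rooted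
representatives `l` of `ℓ`. -/
noncomputable def loopMeasure (q : Site → Site → ℝ) (ℓ : Cycle Site) : ℝ :=
  ∑ l ∈ ℓ.lists.toFinset, pathWeight q (closeUp l) / l.length

/-- The loop measure of a set of unrooted loops. -/
noncomputable def loopMass (q : Site → Site → ℝ) (L : Set (Cycle Site)) : ℝ :=
  ∑' ℓ : L, loopMeasure q ℓ

end LoopErased

namespace LoopErased
open Finset

/-! ### Steps and weights of paths -/

/-! Both weights are symmetric and bounded in absolute value by `srw A`, so the general theory is
done for any such weight `w`. The function constant minus `|z|²` drops by exactly 1 under averaging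
over neighbours; it bounds all masses and gives a maximum principle.

Comparing the measures. Erasing loops one vertex at a time writes the loop-erased measure of `η` as
`w(η)` times Green's functions on shrinking domains. By Cramer's rule each of these is a ratio of
determinants of `1 - w`, and the product telescopes to `w(η) det(A \ η) / det(A)`
(`loopErasedMeasure_mul_lapDet`). Moreover `-log det` is the total mass of rooted loops
(`hasSum_rootedLoops`). A walk `η` through the origin joins it to the complement of `A`, so a loop
avoiding `η` has even winding around the top of the zipper, as it has around the bottom, and crosses
the zipper evenly (`zipperSign_closeUp_eq_one`). Hence `p` and `q` have the same determinant on `A \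
η`. On `A` the logarithms differ by twice the mass of the odd loops, and the only other change is
the sign `(-1)^crossings` of `η`. Positive ordering says that this sign is `+` for walks through `0
→ 1` and `-` for walks through `1 → 0`; summing over `η` gives `expect_usesUndirected`.

Determinantal formula. Fomin's identity for one edge (`expect_usesDirected_sub`) says that the mass
through `a → b` minus the mass through `b → a` is `w a b` times a 2 × 2 determinant of kernels on
`A`. Removing `a` and then `b` from the domain extracts the two Green's functions of `loopFactor`.
-/

@[simp] lemma steps_nil : steps [] = [] := rfl
@[simp] lemma steps_singleton (u : Site) : steps [u] = [] := rfl
@[simp] lemma steps_cons_cons (u v : Site) (t : List Site) :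
    steps (u :: v :: t) = (u, v) :: steps (v :: t) := rfl

@[simp] lemma pathWeight_nil (w : Site → Site → ℝ) : pathWeight w [] = 1 := rfl
@[simp] lemma pathWeight_singleton (w : Site → Site → ℝ) (u : Site) : pathWeight w [u] = 1 := rfl
@[simp] lemma pathWeight_cons_cons (w : Site → Site → ℝ) (u v : Site) (t : List Site) :
    pathWeight w (u :: v :: t) = w u v * pathWeight w (v :: t) := by
  simp [pathWeight]

lemma steps_append {a t : List Site} {z : Site} (ha : a.getLast? = some z) :
    steps (a ++ t) = steps a ++ steps (z :: t) := by
  induction a with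
  | nil => simp at ha
  | cons u a ih =>
    cases a with
    | nil => simp at ha; subst ha; simp
    | cons v a =>
      simp only [List.cons_append, steps_cons_cons] at ih ⊢
      rw [ih (by simpa using ha)]

lemma pathWeight_append (w : Site → Site → ℝ) {a t : List Site} {z : Site}
    (ha : a.getLast? = some z) :
    pathWeight w (a ++ t) = pathWeight w a * pathWeight w (z :: t) := by
  simp [pathWeight, steps_append ha]

lemma steps_reverse (ω : List Site) : steps ω.reverse = ((steps ω).map Prod.swap).reverse := by
  induction ω with
  | nil => rfl
  | cons u ω ih =>
    cases ω with
    | nil => rfl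
    | cons v ω =>
      rw [List.reverse_cons, steps_append (z := v) (by simp), ih]
      simp

lemma pathWeight_reverse {w : Site → Site → ℝ} (hs : ∀ u v, w u v = w v u) (ω : List Site) :
    pathWeight w ω.reverse = pathWeight w ω := by
  unfold pathWeight
  rw [steps_reverse, List.map_reverse, List.prod_reverse, List.map_map]
  congr 2
  funext e
  exact hs _ _

lemma pathWeight_mul (w w' : Site → Site → ℝ) (ω : List Site) :
    pathWeight (fun u v => w u v * w' u v) ω = pathWeight w ω * pathWeight w' ω := by
  simp [pathWeight, List.prod_map_mul]

lemma pathWeight_congr {w w' : Site → Site → ℝ} {ω : List Site}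
    (h : ∀ e ∈ steps ω, w e.1 e.2 = w' e.1 e.2) : pathWeight w ω = pathWeight w' ω := by
  unfold pathWeight
  rw [List.map_congr_left h]

lemma pathWeight_eq_one {w : Site → Site → ℝ} {ω : List Site}
    (h : ∀ e ∈ steps ω, w e.1 e.2 = 1) : pathWeight w ω = 1 := by
  unfold pathWeight
  rw [List.map_congr_left h]
  simp

lemma pathWeight_abs (w : Site → Site → ℝ) (ω : List Site) :
    |pathWeight w ω| = pathWeight (fun u v => |w u v|) ω := by
  induction ω with
  | nil => simp
  | cons u ω ih =>
    cases ω with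
    | nil => simp
    | cons v ω => simp [abs_mul, ih]

lemma pathWeight_nonneg {w : Site → Site → ℝ} (h : ∀ u v, 0 ≤ w u v) (ω : List Site) :
    0 ≤ pathWeight w ω := by
  unfold pathWeight
  apply List.prod_nonneg
  simp only [List.mem_map]
  rintro _ ⟨e, -, rfl⟩
  exact h _ _

lemma pathWeight_mono {w w' : Site → Site → ℝ} (h0 : ∀ u v, 0 ≤ w u v)
    (h : ∀ u v, w u v ≤ w' u v) (ω : List Site) : pathWeight w ω ≤ pathWeight w' ω := by
  induction ω with
  | nil => simp
  | cons u ω ih =>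
    cases ω with
    | nil => simp
    | cons v ω =>
      simp only [pathWeight_cons_cons]
      exact mul_le_mul (h u v) ih (pathWeight_nonneg h0 _) ((h0 u v).trans (h u v))

lemma mem_of_mem_steps {e : Site × Site} {ω : List Site} (h : e ∈ steps ω) :
    e.1 ∈ ω ∧ e.2 ∈ ω := by
  induction ω with
  | nil => simp at h
  | cons u ω ih =>
    cases ω with
    | nil => simp at h
    | cons v ω =>
      rw [steps_cons_cons, List.mem_cons] at h
      rcases h with rfl | h
      · simp
      · exact ⟨List.mem_cons_of_mem _ (ih h).1, List.mem_cons_of_mem _ (ih h).2⟩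

lemma snd_mem_tail_of_mem_steps {e : Site × Site} {ω : List Site} (h : e ∈ steps ω) :
    e.2 ∈ ω.tail :=
  (List.of_mem_zip (show (e.1, e.2) ∈ _ from h)).2

lemma adj_of_mem_steps {e : Site × Site} {ω : List Site} (hω : ω.IsChain lattice.Adj)
    (h : e ∈ steps ω) : lattice.Adj e.1 e.2 := by
  induction ω with
  | nil => simp at h
  | cons u ω ih =>
    cases ω with
    | nil => simp at h
    | cons v ω =>
      rw [steps_cons_cons, List.mem_cons] at h
      rw [List.isChain_cons_cons] at hω
      rcases h with rfl | h
      · exact hω.1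
      · exact ih hω.2 h

lemma pathWeight_eq_zero_of_not_isChain {w : Site → Site → ℝ}
    (hw : ∀ u v, ¬ lattice.Adj u v → w u v = 0) {ω : List Site}
    (h : ¬ ω.IsChain lattice.Adj) : pathWeight w ω = 0 := by
  induction ω with
  | nil => simp at h
  | cons u ω ih =>
    cases ω with
    | nil => simp at h
    | cons v ω =>
      rw [List.isChain_cons_cons, not_and_or] at h
      rw [pathWeight_cons_cons]
      rcases h with h | h
      · rw [hw u v h, zero_mul]
      · rw [ih h, mul_zero]

/-! ### Walks -/

@[simp] lemma nil_notMem_walks (B : Finset Site) (x y : Site) : [] ∉ walks B x y := by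
  simp [walks]

@[simp] lemma singleton_mem_walks {B : Finset Site} {x y u : Site} :
    [u] ∈ walks B x y ↔ u = x ∧ u = y := by
  simp [walks]

lemma cons_cons_mem_walks {B : Finset Site} {x y u v : Site} {t : List Site} :
    u :: v :: t ∈ walks B x y ↔
      u = x ∧ lattice.Adj u v ∧ v :: t ∈ walks B v y ∧ (t = [] ∨ v ∈ B) := by
  cases t with
  | nil => simp [walks]; tauto
  | cons z t =>
    simp only [walks, Set.mem_ofPred_eq, List.head?_cons, Option.some.injEq,
      List.getLast?_cons_cons, List.isChain_cons_cons, List.tail_cons, List.dropLast_cons_cons,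
      List.mem_cons, forall_eq_or_imp, reduceCtorEq, false_or, true_and]
    tauto

lemma head_eq_of_cons_mem_walks {B : Finset Site} {x y u : Site} {t : List Site}
    (h : u :: t ∈ walks B x y) : u = x := by
  have := h.1
  simpa using this

lemma exists_cons_of_mem_walks {B : Finset Site} {x y : Site} {ω : List Site}
    (h : ω ∈ walks B x y) : ∃ t, ω = x :: t := by
  cases ω with
  | nil => simp at h
  | cons u t => exact ⟨t, by rw [head_eq_of_cons_mem_walks h]⟩

lemma mem_of_mem_walks {B : Finset Site} {y : Site} {ω : List Site} {x z : Site}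
    (h : ω ∈ walks B x y) (hz : z ∈ ω) : z = x ∨ z = y ∨ z ∈ B := by
  induction ω generalizing x with
  | nil => simp at h
  | cons u ω ih =>
    obtain rfl := head_eq_of_cons_mem_walks h
    cases ω with
    | nil => left; simpa using hz
    | cons v ω =>
      rw [cons_cons_mem_walks] at h
      rcases List.mem_cons.1 hz with hz | hz
      · exact .inl hz
      · rcases ih h.2.2.1 hz with rfl | hz
        · rcases h.2.2.2 with rfl | hv
          · have := h.2.2.1
            simp at this
            exact .inr (.inl this)
          · exact .inr (.inr hv)
        · exact .inr hz

lemma reverse_mem_walks {B : Finset Site} {x y : Site} {ω : List Site} (h : ω ∈ walks B x y) :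
    ω.reverse ∈ walks B y x := by
  refine ⟨by rw [List.head?_reverse]; exact h.2.1, by rw [List.getLast?_reverse]; exact h.1,
    ?_, ?_⟩
  · rw [List.isChain_reverse]
    exact h.2.2.1.imp fun _ _ hab => hab.symm
  · intro z hz
    apply h.2.2.2
    rw [List.tail_reverse, List.dropLast_reverse, List.mem_reverse, List.tail_dropLast] at hz
    exact hz

/-! ### The simple random walk weight -/

lemma srw_nonneg (A : Finset Site) (u v : Site) : 0 ≤ srw A u v := by
  unfold srw; split_ifs <;> norm_num

lemma srw_le (A : Finset Site) (u v : Site) : srw A u v ≤ 1 / 4 := by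
  unfold srw; split_ifs <;> norm_num

lemma srw_eq_zero {A : Finset Site} {u v : Site} (h : ¬ lattice.Adj u v) : srw A u v = 0 := by
  simp [srw, h]

lemma srw_symm (A : Finset Site) (u v : Site) : srw A u v = srw A v u := by
  have h : lattice.Adj u v ∧ (u ∈ A ∨ v ∈ A) ↔ lattice.Adj v u ∧ (v ∈ A ∨ u ∈ A) := by
    rw [lattice.adj_comm, or_comm]
  unfold srw
  split_ifs <;> tauto

/-- The four nearest neighbours of a point. -/
def nbrs (u : Site) : Finset Site :=
  {(u.1 + 1, u.2), (u.1 - 1, u.2), (u.1, u.2 + 1), (u.1, u.2 - 1)}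

lemma adj_iff_mem_nbrs {u v : Site} : lattice.Adj u v ↔ v ∈ nbrs u := by
  obtain ⟨a, b⟩ := u
  obtain ⟨c, d⟩ := v
  simp only [lattice, nbrs, mem_insert, mem_singleton, Prod.mk.injEq]
  rcases abs_cases (a - c) with h | h <;> rcases abs_cases (b - d) with h' | h' <;> omega

lemma sum_nbrs (u : Site) (f : Site → ℝ) :
    ∑ v ∈ nbrs u, f v =
      f (u.1 + 1, u.2) + f (u.1 - 1, u.2) + f (u.1, u.2 + 1) + f (u.1, u.2 - 1) := by
  have h1 : u.1 + 1 ≠ u.1 - 1 := by omega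
  have h2 : u.2 + 1 ≠ u.2 - 1 := by omega
  unfold nbrs
  rw [sum_insert (by simp [h1]), sum_insert (by simp),
    sum_insert (by simp [h2]), sum_singleton]
  ring

lemma sum_srw_mul_le (A B : Finset Site) (u : Site) {f : Site → ℝ}
    (hf : ∀ v ∈ nbrs u, 0 ≤ f v) :
    ∑ v ∈ B, srw A u v * f v ≤ ∑ v ∈ nbrs u, 1 / 4 * f v := by
  calc ∑ v ∈ B, srw A u v * f v = ∑ v ∈ B with v ∈ nbrs u, srw A u v * f v := by
        symm
        apply sum_filter_of_ne
        intro v _ h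
        by_contra h'
        exact h (by rw [srw_eq_zero (by rwa [adj_iff_mem_nbrs]), zero_mul])
    _ ≤ ∑ v ∈ B with v ∈ nbrs u, 1 / 4 * f v := by
        apply sum_le_sum
        intro v hv
        exact mul_le_mul_of_nonneg_right (srw_le _ _ _) (hf v (mem_filter.1 hv).2)
    _ ≤ ∑ v ∈ nbrs u, 1 / 4 * f v := by
        apply sum_le_sum_of_subset_of_nonneg
        · intro v hv; exact (mem_filter.1 hv).2
        · intro v hv _
          have := hf v hv
          positivity

/-- A strictly superharmonic function on `A`, positive on `A` and its boundary: a constant minus the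
square of the modulus. -/
lemma exists_superharmonic (A : Finset Site) :
    ∃ h : Site → ℝ, (∃ C, ∀ v, h v ≤ C) ∧ (∀ u ∈ A, 1 ≤ h u ∧ ∀ v ∈ nbrs u, 1 ≤ h v) ∧
      ∀ u, ∑ v ∈ nbrs u, 1 / 4 * h v = h u - 1 := by
  -- Each summand dominates `|v|²` at `z` and at its four neighbours, so one constant serves all of
  -- `A`; the extra 1 leaves the value at least 1 there.
  set C : ℝ := 1 + ∑ z ∈ A, ((|(z.1 : ℝ)| + 1) ^ 2 + (|(z.2 : ℝ)| + 1) ^ 2) with hC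
  refine ⟨fun v => C - ((v.1 : ℝ) ^ 2 + (v.2 : ℝ) ^ 2), ⟨C, fun v => ?_⟩, fun u hu => ?_,
    fun u => ?_⟩
  · have := sq_nonneg (v.1 : ℝ)
    have := sq_nonneg (v.2 : ℝ)
    simp only
    linarith
  · have hle : (|(u.1 : ℝ)| + 1) ^ 2 + (|(u.2 : ℝ)| + 1) ^ 2 ≤ C - 1 := by
      rw [hC, add_sub_cancel_left]
      exact single_le_sum (f := fun z : Site => (|(z.1 : ℝ)| + 1) ^ 2 + (|(z.2 : ℝ)| + 1) ^ 2)
        (fun _ _ => by positivity) hu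
    have key : ∀ v : Site, |(v.1 : ℝ)| ≤ |(u.1 : ℝ)| + 1 → |(v.2 : ℝ)| ≤ |(u.2 : ℝ)| + 1 →
        1 ≤ C - ((v.1 : ℝ) ^ 2 + (v.2 : ℝ) ^ 2) := by
      intro v h1 h2
      have h1' := pow_le_pow_left₀ (abs_nonneg _) h1 2
      have h2' := pow_le_pow_left₀ (abs_nonneg _) h2 2
      rw [sq_abs] at h1' h2'
      linarith
    have hone : |(1 : ℝ)| = 1 := abs_one
    refine ⟨key u (by linarith) (by linarith), fun v hv => ?_⟩
    simp only [nbrs, mem_insert, mem_singleton] at hv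
    rcases hv with rfl | rfl | rfl | rfl <;> apply key <;> push_cast <;>
      first
        | linarith
        | exact (abs_add_le _ _).trans (by rw [hone])
        | exact (abs_sub _ _).trans (by rw [hone])
  · rw [sum_nbrs]
    push_cast
    ring

/-- Maximum principle for weights dominated by killed simple random walk. -/
lemma eq_zero_of_abs_le_sum {A B : Finset Site} (hB : B ⊆ A) {f : Site → ℝ}
    (hf : ∀ u ∈ B, |f u| ≤ ∑ v ∈ B, srw A u v * |f v|) : ∀ u ∈ B, f u = 0 := by
  obtain ⟨h, -, h1, h2⟩ := exists_superharmonic A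
  intro u hu
  -- At a maximum of `|f| / h`, with value `M`, the hypothesis and superharmonicity give `M h(z) ≤ M
  -- (h(z) - 1)`, so `M = 0`.
  obtain ⟨z, hz, hmax⟩ := exists_max_image B (fun v => |f v| / h v) ⟨u, hu⟩
  have hpos : ∀ v ∈ B, 0 < h v := fun v hv => one_pos.trans_le (h1 v (hB hv)).1
  set M := |f z| / h z with hM
  have hM0 : 0 ≤ M := div_nonneg (abs_nonneg _) (hpos z hz).le
  have hle : ∀ v ∈ B, |f v| ≤ M * h v := fun v hv => by
    have := hmax v hv
    rwa [div_le_iff₀ (hpos v hv)] at this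
  have h3 : |f z| ≤ M * (h z - 1) := by
    calc |f z| ≤ ∑ v ∈ B, srw A z v * |f v| := hf z hz
      _ ≤ ∑ v ∈ B, M * (srw A z v * h v) := by
          apply sum_le_sum
          intro v hv
          have := mul_le_mul_of_nonneg_left (hle v hv) (srw_nonneg A z v)
          linarith
      _ = M * ∑ v ∈ B, srw A z v * h v := by rw [mul_sum]
      _ ≤ M * (h z - 1) := by
          rw [← h2 z]
          exact mul_le_mul_of_nonneg_left
            (sum_srw_mul_le A B z fun v hv => zero_le_one.trans ((h1 z (hB hz)).2 v hv)) hM0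
  have h4 : |f z| = M * h z := by rw [hM, div_mul_cancel₀ _ (hpos z hz).ne']
  have h5 : M = 0 := by nlinarith
  have := hle u hu
  rw [h5, zero_mul] at this
  exact abs_eq_zero.1 (le_antisymm this (abs_nonneg _))

/-! ### Absolute convergence -/

/-- Induction step for bounding finite partial sums: the 1 pays for the path `[x]`, and every other
path steps to some `z` and either stops there or has `z ∈ B`, which is all that `K z` must cover. -/
lemma sum_pathWeight_le_step {A B : Finset Site} {n : ℕ} {y : Site} {K : Site → ℝ} {x : Site}
    (hK : ∀ z ∈ nbrs x, ∀ s : Finset (List Site),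
      (∀ ω ∈ s, ω ∈ walks B z y ∧ ω.length ≤ n ∧ (ω = [z] ∨ z ∈ B)) →
        ∑ ω ∈ s, pathWeight (srw A) ω ≤ K z)
    (s : Finset (List Site)) (hs : ∀ ω ∈ s, ω ∈ walks B x y ∧ ω.length ≤ n + 1) :
    ∑ ω ∈ s, pathWeight (srw A) ω ≤ 1 + ∑ z ∈ nbrs x, 1 / 4 * K z := by
  classical
  have hp : ∀ ω, 0 ≤ pathWeight (srw A) ω := pathWeight_nonneg (srw_nonneg A)
  have hsub : s ⊆ {[x]} ∪ (nbrs x).biUnion fun z => s.filter fun ω => ∃ t, ω = x :: z :: t := by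
    intro ω hω
    have h := (hs ω hω).1
    obtain ⟨t, rfl⟩ := exists_cons_of_mem_walks h
    cases t with
    | nil => simp
    | cons z t =>
      rw [cons_cons_mem_walks] at h
      simp only [mem_union, mem_biUnion, mem_filter]
      exact .inr ⟨z, adj_iff_mem_nbrs.1 h.2.1, hω, t, rfl⟩
  calc ∑ ω ∈ s, pathWeight (srw A) ω
      ≤ ∑ ω ∈ {[x]} ∪ (nbrs x).biUnion fun z => s.filter fun ω => ∃ t, ω = x :: z :: t,
          pathWeight (srw A) ω := sum_le_sum_of_subset_of_nonneg hsub fun _ _ _ => hp _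
    _ ≤ ∑ ω ∈ {[x]}, pathWeight (srw A) ω +
          ∑ ω ∈ (nbrs x).biUnion fun z => s.filter fun ω => ∃ t, ω = x :: z :: t,
            pathWeight (srw A) ω := by
        rw [← sum_union_inter]
        exact le_add_of_nonneg_right (sum_nonneg fun _ _ => hp _)
    _ ≤ 1 + ∑ z ∈ nbrs x, 1 / 4 * K z := by
        rw [sum_singleton, pathWeight_singleton]
        gcongr
        rw [sum_biUnion]
        · apply sum_le_sum
          intro z hz
          have hinj : Set.InjOn List.tail
              (s.filter fun ω => ∃ t, ω = x :: z :: t : Set (List Site)) := by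
            intro a ha b hb hab
            simp only [coe_filter, Set.mem_ofPred_eq] at ha hb
            obtain ⟨-, t, rfl⟩ := ha
            obtain ⟨-, t', rfl⟩ := hb
            simpa using hab
          calc ∑ ω ∈ s with ∃ t, ω = x :: z :: t, pathWeight (srw A) ω
              = ∑ ω ∈ s with ∃ t, ω = x :: z :: t, srw A x z * pathWeight (srw A) ω.tail := by
                apply sum_congr rfl
                intro ω hω
                obtain ⟨t, rfl⟩ := (mem_filter.1 hω).2
                simp
            _ = srw A x z * ∑ ω ∈ (s.filter fun ω => ∃ t, ω = x :: z :: t).image List.tail,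
                  pathWeight (srw A) ω := by
                rw [sum_image hinj, mul_sum]
            _ ≤ 1 / 4 * K z := by
                refine mul_le_mul (srw_le _ _ _) (hK z hz _ ?_) (sum_nonneg fun _ _ => hp _)
                  (by norm_num)
                intro ω hω
                simp only [mem_image, mem_filter] at hω
                obtain ⟨_, ⟨hω, t, rfl⟩, rfl⟩ := hω
                obtain ⟨h1, h2⟩ := hs _ hω
                rw [cons_cons_mem_walks] at h1
                refine ⟨h1.2.2.1, by simpa using h2, ?_⟩
                rcases h1.2.2.2 with rfl | h
                · exact .inl rfl
                · exact .inr h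
        · intro a _ b _ hab
          simp only [Function.onFun]
          rw [disjoint_left]
          intro ω h1 h2
          obtain ⟨t, rfl⟩ := (mem_filter.1 h1).2
          obtain ⟨t', h⟩ := (mem_filter.1 h2).2
          simp only [List.cons.injEq, true_and] at h
          exact hab h.1

lemma summable_pathWeight_srw {A B : Finset Site} (hB : B ⊆ A) (x y : Site) :
    Summable fun ω : walks B x y => pathWeight (srw A) ω := by
  classical
  obtain ⟨h, ⟨C, hC⟩, h1, h2⟩ := exists_superharmonic A
  have hp : ∀ ω, 0 ≤ pathWeight (srw A) ω := pathWeight_nonneg (srw_nonneg A)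
  have hsing : ∀ z, ∀ s : Finset (List Site), (∀ ω ∈ s, ω = [z]) →
      ∑ ω ∈ s, pathWeight (srw A) ω ≤ 1 := by
    intro z s hs
    calc ∑ ω ∈ s, pathWeight (srw A) ω ≤ ∑ ω ∈ {[z]}, pathWeight (srw A) ω :=
          sum_le_sum_of_subset_of_nonneg (fun ω hω => by simp [hs ω hω]) fun _ _ _ => hp _
      _ = 1 := by simp
  -- The bound `h` reproduces itself: averaging loses 1, which is what the trivial path costs. At
  -- neighbours outside `B` only the trivial path remains, and `h ≥ 1` suffices.
  have key : ∀ n, ∀ x ∈ B, ∀ s : Finset (List Site),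
      (∀ ω ∈ s, ω ∈ walks B x y ∧ ω.length ≤ n) → ∑ ω ∈ s, pathWeight (srw A) ω ≤ h x := by
    intro n
    induction n with
    | zero =>
      intro x hx s hs
      rw [sum_eq_zero]
      · exact zero_le_one.trans (h1 x (hB hx)).1
      · intro ω hω
        have := hs ω hω
        have h0 : ω = [] := List.length_eq_zero_iff.1 (Nat.le_zero.1 this.2)
        exact absurd (h0 ▸ this.1) (nil_notMem_walks _ _ _)
    | succ n ih =>
      intro x hx s hs
      have := sum_pathWeight_le_step (A := A) (K := h) ?_ s hs
      · rw [h2 x] at this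
        linarith
      · intro z hz s hs
        by_cases hzB : z ∈ B
        · exact ih z hzB s fun ω hω => ⟨(hs ω hω).1, (hs ω hω).2.1⟩
        · exact (hsing z s fun ω hω => (hs ω hω).2.2.resolve_right hzB).trans
            ((h1 x (hB hx)).2 z hz)
  -- The starting point `x` may lie far from `A`, where `h` can be negative, so one further step is
  -- taken with the crude bound `max 1 C`.
  have hbound : ∀ s : Finset (List Site), (∀ ω ∈ s, ω ∈ walks B x y) →
      ∑ ω ∈ s, pathWeight (srw A) ω ≤ 1 + ∑ z ∈ nbrs x, 1 / 4 * max 1 C := by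
    intro s hs
    refine sum_pathWeight_le_step (A := A) (B := B) (n := s.sup List.length) (y := y)
      (K := fun _ => max 1 C) ?_ s
      fun ω hω => ⟨hs ω hω, (le_sup (f := List.length) hω).trans (Nat.le_succ _)⟩
    intro z hz s' hs'
    by_cases hzB : z ∈ B
    · exact (key _ z hzB s' fun ω hω => ⟨(hs' ω hω).1, (hs' ω hω).2.1⟩).trans
        ((hC z).trans (le_max_right _ _))
    · exact (hsing z s' fun ω hω => (hs' ω hω).2.2.resolve_right hzB).trans (le_max_left _ _)
  refine summable_of_sum_le (fun ω => hp _) (fun s => ?_)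
    (c := 1 + ∑ z ∈ nbrs x, 1 / 4 * max 1 C)
  have := hbound (s.map (Function.Embedding.subtype _)) (by
    intro ω hω
    simp only [mem_map, Function.Embedding.subtype_apply] at hω
    obtain ⟨ω, -, rfl⟩ := hω
    exact ω.2)
  simpa using this

/-- Weights dominated by simple random walk: bounded functions of paths are summable. -/
lemma summable_norm_mul_pathWeight {A B : Finset Site} (hB : B ⊆ A) {w : Site → Site → ℝ}
    (hw : ∀ u v, |w u v| ≤ srw A u v) (x y : Site) {F : List Site → ℝ} (hF : ∀ ω, |F ω| ≤ 1) :
    Summable fun ω : walks B x y => ‖F ω * pathWeight w ω‖ := by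
  refine Summable.of_nonneg_of_le (fun _ => norm_nonneg _) (fun ω => ?_)
    (summable_pathWeight_srw hB x y)
  rw [norm_mul, Real.norm_eq_abs, Real.norm_eq_abs, pathWeight_abs]
  have h1 := pathWeight_mono (fun u v => abs_nonneg (w u v)) hw ω
  have h2 : 0 ≤ pathWeight (fun u v => |w u v|) ω := pathWeight_nonneg (fun _ _ => abs_nonneg _) _
  nlinarith [hF ω, abs_nonneg (F ω)]

lemma summable_mul_pathWeight {A B : Finset Site} (hB : B ⊆ A) {w : Site → Site → ℝ}
    (hw : ∀ u v, |w u v| ≤ srw A u v) (x y : Site) {F : List Site → ℝ} (hF : ∀ ω, |F ω| ≤ 1) :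
    Summable fun ω : walks B x y => F ω * pathWeight w ω :=
  (summable_norm_mul_pathWeight hB hw x y hF).of_norm

/-! ### Loop erasure -/

@[simp] lemma loopErase_nil : loopErase [] = [] := by rw [loopErase]

lemma loopErase_cons (x : Site) (t : List Site) :
    loopErase (x :: t) = x :: loopErase (t.rtakeWhile fun z => z ≠ x) := by rw [loopErase]

lemma loopErase_cons_of_notMem {x : Site} {t : List Site} (h : x ∉ t) :
    loopErase (x :: t) = x :: loopErase t := by
  rw [loopErase_cons, List.rtakeWhile_eq_self_iff.2]
  intro z hz
  simp only [ne_eq, decide_not, Bool.not_eq_eq_eq_not, Bool.not_true, decide_eq_false_iff_not]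
  rintro rfl
  exact h hz

lemma rtakeWhile_append_of_notMem {a t : List Site} {z : Site} (ha : a.getLast? = some z)
    (ht : z ∉ t) : (a ++ t).rtakeWhile (fun v => v ≠ z) = t := by
  induction t using List.reverseRecOn with
  | nil =>
    rw [List.append_nil, List.rtakeWhile_eq_nil_iff]
    intro hl
    rw [List.getLast?_eq_some_getLast hl, Option.some.injEq] at ha
    simp [ha]
  | append_singleton t v ih =>
    simp only [List.mem_append, List.mem_singleton, not_or] at ht
    rw [← List.append_assoc, List.rtakeWhile_concat_pos, ih ht.1]
    simpa using Ne.symm ht.2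

/-- Erasure at `z` keeps only what follows the last visit to `z`, so a closed initial piece has no
influence. -/
lemma loopErase_append {a t : List Site} {z : Site} (hh : a.head? = some z)
    (ha : a.getLast? = some z) (ht : z ∉ t) : loopErase (a ++ t) = loopErase (z :: t) := by
  cases a with
  | nil => simp at hh
  | cons u a =>
    simp only [List.head?_cons, Option.some.injEq] at hh
    subst hh
    cases a with
    | nil => rfl
    | cons v a =>
      rw [List.cons_append, loopErase_cons, loopErase_cons_of_notMem ht,
        rtakeWhile_append_of_notMem (by simpa using ha) ht]

lemma rtakeWhile_ne_decomp {ω : List Site} {z : Site} (hz : z ∈ ω) :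
    ∃ a t, ω = a ++ t ∧ a.getLast? = some z ∧ z ∉ t ∧ ω.rtakeWhile (fun v => v ≠ z) = t := by
  refine ⟨ω.rdropWhile fun v => v ≠ z, ω.rtakeWhile fun v => v ≠ z,
    List.rdropWhile_append_rtakeWhile.symm, ?_, ?_, rfl⟩
  · have hne : (ω.rdropWhile fun v => v ≠ z) ≠ [] := by
      intro h
      rw [List.rdropWhile_eq_nil_iff] at h
      simpa using h z hz
    rw [List.getLast?_eq_some_getLast hne]
    have := List.rdropWhile_last_not (fun v => decide (v ≠ z)) ω hne
    simpa using this
  · intro h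
    simpa using List.mem_rtakeWhile_imp h

/-! ### Concatenation of walks -/

lemma walks_mono {B C : Finset Site} (h : B ⊆ C) (x y : Site) : walks B x y ⊆ walks C x y :=
  fun _ hω => ⟨hω.1, hω.2.1, hω.2.2.1, fun z hz => h (hω.2.2.2 z hz)⟩

lemma mem_tail_of_mem_walks {B : Finset Site} {x y z : Site} {t : List Site}
    (h : x :: t ∈ walks B x y) (hz : z ∈ t) : z = y ∨ z ∈ B := by
  cases t with
  | nil => simp at hz
  | cons v t =>
    rw [cons_cons_mem_walks] at h
    rcases mem_of_mem_walks h.2.2.1 hz with rfl | h'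
    · rcases h.2.2.2 with rfl | hv
      · have := h.2.2.1
        simp at this
        exact .inl this
      · exact .inr hv
    · exact h'

lemma append_mem_walks {B : Finset Site} {x y z : Site} (hz : z ∈ B) {a t : List Site}
    (ha : a ∈ walks B x z) (ht : z :: t ∈ walks B z y) : a ++ t ∈ walks B x y := by
  induction a generalizing x with
  | nil => simp at ha
  | cons u a ih =>
    cases a with
    | nil =>
      simp only [singleton_mem_walks] at ha
      obtain ⟨rfl, rfl⟩ := ha
      exact ht
    | cons v a =>
      rw [cons_cons_mem_walks] at ha
      rw [List.cons_append, List.cons_append, cons_cons_mem_walks]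
      refine ⟨ha.1, ha.2.1, ih ha.2.2.1, .inr ?_⟩
      rcases ha.2.2.2 with rfl | hv
      · have := ha.2.2.1
        simp only [singleton_mem_walks, true_and] at this
        exact this ▸ hz
      · exact hv

lemma mem_walks_of_append {B : Finset Site} {x y z : Site} {a t : List Site}
    (hl : a.getLast? = some z) (h : a ++ t ∈ walks B x y) :
    a ∈ walks B x z ∧ z :: t ∈ walks B z y := by
  induction a generalizing x with
  | nil => simp at hl
  | cons u a ih =>
    cases a with
    | nil =>
      simp only [List.getLast?_singleton, Option.some.injEq] at hl
      subst hl
      obtain rfl := head_eq_of_cons_mem_walks h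
      exact ⟨by simp, h⟩
    | cons v a =>
      rw [List.cons_append, List.cons_append, cons_cons_mem_walks] at h
      obtain ⟨h1, h2⟩ := ih (by simpa using hl) h.2.2.1
      refine ⟨?_, h2⟩
      rw [cons_cons_mem_walks]
      refine ⟨h.1, h.2.1, h1, h.2.2.2.imp_left fun h => ?_⟩
      exact (List.append_eq_nil_iff.1 h).1

lemma mem_walks_erase {B : Finset Site} {z y : Site} {t : List Site}
    (h : z :: t ∈ walks B z y) (hz : z ∉ t) : z :: t ∈ walks (B.erase z) z y := by
  refine ⟨h.1, h.2.1, h.2.2.1, fun v hv => mem_erase.2 ⟨?_, h.2.2.2 v hv⟩⟩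
  rintro rfl
  exact hz (List.mem_of_mem_dropLast hv)

lemma notMem_tail_of_mem_walks_erase {B : Finset Site} {z y : Site} (hy : y ≠ z) {t : List Site}
    (h : z :: t ∈ walks (B.erase z) z y) : z ∉ t := by
  intro hz
  rcases mem_tail_of_mem_walks h hz with h | h
  · exact hy h.symm
  · simp at h

/-- Decomposition of a walk started at `z` at its last visit to `z`. -/
lemma bijective_append_tail {B : Finset Site} {z y : Site} (hz : z ∈ B) (hy : y ≠ z) :
    Function.Bijective fun p : walks B z z × walks (B.erase z) z y =>
      (⟨p.1.1 ++ p.2.1.tail, by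
        obtain ⟨t, ht⟩ := exists_cons_of_mem_walks p.2.2
        refine append_mem_walks hz p.1.2 ?_
        have := p.2.2
        rw [ht] at this ⊢
        exact walks_mono (erase_subset _ _) _ _ this⟩ : walks B z y) := by
  constructor
  · rintro ⟨⟨a, ha⟩, ⟨b, hb⟩⟩ ⟨⟨a', ha'⟩, ⟨b', hb'⟩⟩ h
    obtain ⟨t, rfl⟩ := exists_cons_of_mem_walks hb
    obtain ⟨t', rfl⟩ := exists_cons_of_mem_walks hb'
    simp only [List.tail_cons, Subtype.mk.injEq] at h
    have h1 := rtakeWhile_append_of_notMem ha.2.1 (notMem_tail_of_mem_walks_erase hy hb)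
    have h2 := rtakeWhile_append_of_notMem ha'.2.1 (notMem_tail_of_mem_walks_erase hy hb')
    obtain rfl : t = t' := by rw [← h1, ← h2, h]
    obtain rfl := List.append_cancel_right h
    rfl
  · rintro ⟨ω, hω⟩
    have hzω : z ∈ ω := by
      obtain ⟨t, rfl⟩ := exists_cons_of_mem_walks hω
      simp
    obtain ⟨a, t, rfl, ha, ht, -⟩ := rtakeWhile_ne_decomp hzω
    obtain ⟨h1, h2⟩ := mem_walks_of_append ha hω
    exact ⟨⟨⟨a, h1⟩, ⟨z :: t, mem_walks_erase h2 ht⟩⟩, rfl⟩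

/-! ### Identities between total masses -/

variable {A B : Finset Site} {w : Site → Site → ℝ}

lemma mass_eq_expect (w : Site → Site → ℝ) (B : Finset Site) (x y : Site) :
    mass w B x y = expect w B x y fun _ => 1 := by
  simp [mass, expect]

lemma expect_congr {x y : Site} {X Y : List Site → ℝ} (h : ∀ ω ∈ walks B x y, X ω = Y ω) :
    expect w B x y X = expect w B x y Y :=
  tsum_congr fun ω => by rw [h ω ω.2]

lemma eq_zero_of_not_adj (hw : ∀ u v, |w u v| ≤ srw A u v) {u v : Site}
    (h : ¬ lattice.Adj u v) : w u v = 0 := by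
  have := hw u v
  rw [srw_eq_zero h] at this
  exact abs_eq_zero.1 (le_antisymm this (abs_nonneg _))

/-- A walk is `[x]`, or `[x, y]`, or `x` followed by a walk from a point of `B`. When `y ∈ B` the
path `[x, y]` is already in the last class, so the middle term must vanish. -/
lemma expect_eq_first_step (hB : B ⊆ A) (hw : ∀ u v, |w u v| ≤ srw A u v) (x y : Site)
    {F : List Site → ℝ} (hF : ∀ ω, |F ω| ≤ 1) :
    expect w B x y F = (if x = y then F [x] else 0) + (if y ∈ B then 0 else w x y * F [x, y]) +
      ∑ z ∈ B, w x z * expect w B z y fun t => F (x :: t) := by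
  classical
  set f : List Site → ℝ := fun ω => F ω * pathWeight w ω with hf
  have hz : ∀ z ∈ B, HasSum ((List.cons x '' walks B z y).indicator f)
      (w x z * expect w B z y fun t => F (x :: t)) := by
    intro z _
    have h1 : HasSum (fun t : walks B z y => w x z * (F (x :: t) * pathWeight w t))
        (w x z * expect w B z y fun t => F (x :: t)) :=
      (summable_mul_pathWeight hB hw z y (F := fun t => F (x :: t)) fun _ => hF _).hasSum.mul_left _
    have h2 : HasSum ((f ∘ List.cons x) ∘ ((↑) : walks B z y → List Site))
        (w x z * expect w B z y fun t => F (x :: t)) := by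
      convert h1 using 2 with t
      obtain ⟨t', ht'⟩ := exists_cons_of_mem_walks t.2
      simp only [Function.comp_apply, hf]
      rw [ht', pathWeight_cons_cons]
      ring
    rw [hasSum_subtype_iff_indicator] at h2
    rw [← (List.cons_injective (a := x)).hasSum_iff]
    · convert h2 using 1
      funext t
      exact Set.indicator_image List.cons_injective
    · intro ω hω
      apply Set.indicator_of_notMem
      rintro ⟨t, -, rfl⟩
      exact hω ⟨t, rfl⟩
  have hsum := ((hasSum_ite_eq [x] (if x = y then F [x] else 0)).add
    (hasSum_ite_eq [x, y] (if y ∈ B then 0 else w x y * F [x, y]))).add (hasSum_sum hz)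
  rw [show expect w B x y F = ∑' ω, (walks B x y).indicator f ω from
    tsum_subtype (walks B x y) f, ← hsum.tsum_eq]
  refine tsum_congr fun ω => ?_
  match ω with
  | [] => simp
  | [u] =>
    have : ∀ z ∈ B, (List.cons x '' walks B z y).indicator f [u] = 0 := by
      intro z _
      apply Set.indicator_of_notMem
      rintro ⟨t, ht, h⟩
      simp only [List.cons.injEq] at h
      rw [h.2] at ht
      exact nil_notMem_walks _ _ _ ht
    rw [sum_eq_zero this]
    by_cases hu : u = x
    · subst hu
      by_cases huy : u = y <;> simp [Set.indicator, huy, hf]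
    · simp [Set.indicator, hu]
  | u :: v :: t =>
    have hmem : ∀ z, u :: v :: t ∈ List.cons x '' walks B z y ↔
        u = x ∧ v = z ∧ v :: t ∈ walks B v y := by
      intro z
      constructor
      · rintro ⟨t', ht', h⟩
        simp only [List.cons.injEq] at h
        obtain ⟨rfl, rfl⟩ := h
        obtain rfl := head_eq_of_cons_mem_walks ht'
        exact ⟨rfl, rfl, ht'⟩
      · rintro ⟨rfl, rfl, h⟩
        exact ⟨_, h, rfl⟩
    by_cases hu : u = x
    · subst hu
      by_cases hv : v ∈ B
      · rw [sum_eq_single v]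
        · simp only [Set.indicator, hmem, cons_cons_mem_walks, hv, or_true, and_true, true_and]
          have : ¬ (u :: v :: t = [u, y] ∧ y ∉ B) := by
            simp only [List.cons.injEq, true_and, not_and, not_not]
            rintro ⟨rfl, -⟩; exact hv
          by_cases hadj : lattice.Adj u v
          · by_cases h2 : u :: v :: t = [u, y]
            · have hyB : y ∈ B := by tauto
              simp [hadj, hyB]
            · rw [if_neg h2]; simp [hadj]
          · have h0 : f (u :: v :: t) = 0 := by
              simp [hf, eq_zero_of_not_adj hw hadj]
            by_cases h2 : u :: v :: t = [u, y]
            · have hyB : y ∈ B := by tauto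
              simp [hadj, hyB, h0]
            · rw [if_neg h2]; simp [hadj, h0]
        · intro z _ hzv
          exact Set.indicator_of_notMem (fun h => hzv ((hmem z).1 h).2.1.symm) f
        · exact fun h => absurd hv h
      · rw [sum_eq_zero]
        · by_cases h2 : u :: v :: t = [u, y]
          · simp only [List.cons.injEq, true_and] at h2
            obtain ⟨rfl, rfl⟩ := h2
            by_cases hadj : lattice.Adj u v
            · simp [Set.indicator, cons_cons_mem_walks, hadj, hv, hf, mul_comm]
            · simp [Set.indicator, cons_cons_mem_walks, hadj, hv, eq_zero_of_not_adj hw hadj]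
          · rw [if_neg h2, Set.indicator_of_notMem]
            · simp
            · rw [cons_cons_mem_walks]
              rintro ⟨-, -, h, h' | h'⟩
              · subst h'
                simp only [singleton_mem_walks, true_and] at h
                exact h2 (by rw [h])
              · exact hv h'
        · intro z hz
          exact Set.indicator_of_notMem (fun h => hv (((hmem z).1 h).2.1 ▸ hz)) f
    · rw [sum_eq_zero]
      · simp [Set.indicator, cons_cons_mem_walks, hu]
      · intro z _
        exact Set.indicator_of_notMem (fun h => hu ((hmem z).1 h).1) f

lemma mass_eq_first_step (hB : B ⊆ A) (hw : ∀ u v, |w u v| ≤ srw A u v) (x y : Site) :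
    mass w B x y = (if x = y then 1 else 0) + (if y ∈ B then 0 else w x y) +
      ∑ z ∈ B, w x z * mass w B z y := by
  simp only [mass_eq_expect]
  rw [expect_eq_first_step hB hw x y (F := fun _ => 1) (by simp)]
  simp

/-- Splitting at the last visit to `z` factors the path weight, and the loop erasure depends only on
the second piece. -/
lemma expect_loopErase_of_mem (hB : B ⊆ A) (hw : ∀ u v, |w u v| ≤ srw A u v) {z y : Site}
    (hz : z ∈ B) (hy : y ≠ z) {X : List Site → ℝ} (hX : ∀ η, |X η| ≤ 1) :
    (expect w B z y fun ω => X (loopErase ω)) =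
      mass w B z z * expect w (B.erase z) z y fun ω => X (loopErase ω) := by
  have h1 := summable_norm_mul_pathWeight hB hw z z (F := fun _ => 1) (by simp)
  have h2 := summable_norm_mul_pathWeight ((erase_subset z B).trans hB) hw z y
    (F := fun ω => X (loopErase ω)) fun _ => hX _
  rw [mass_eq_expect]
  unfold expect
  rw [tsum_mul_tsum_of_summable_norm h1 h2,
    ← (Equiv.ofBijective _ (bijective_append_tail hz hy)).tsum_eq]
  refine tsum_congr fun p => ?_
  obtain ⟨⟨a, ha⟩, ⟨b, hb⟩⟩ := p
  obtain ⟨t, rfl⟩ := exists_cons_of_mem_walks hb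
  simp only [Equiv.ofBijective_apply, List.tail_cons]
  rw [loopErase_append ha.1 ha.2.1 (notMem_tail_of_mem_walks_erase hy hb),
    pathWeight_append w ha.2.1]
  ring

lemma mass_mul_mass_erase (hB : B ⊆ A) (hw : ∀ u v, |w u v| ≤ srw A u v) {z y : Site}
    (hz : z ∈ B) (hy : y ≠ z) : mass w B z y = mass w B z z * mass w (B.erase z) z y := by
  simpa only [mass_eq_expect] using expect_loopErase_of_mem hB hw hz hy (X := fun _ => 1) (by simp)

/-- Recursion for the total mass of a function of the loop erasure: after the first step, to `z`,
the walk makes a loop at `z` and never comes back to `z`. -/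
lemma expect_loopErase_recursion (hB : B ⊆ A) (hw : ∀ u v, |w u v| ≤ srw A u v) {x y : Site}
    (hx : x ∉ B) (hy : y ∉ B) (hxy : x ≠ y) {X : List Site → ℝ} (hX : ∀ η, |X η| ≤ 1) :
    (expect w B x y fun ω => X (loopErase ω)) = w x y * X [x, y] +
      ∑ z ∈ B, w x z * (mass w B z z *
        expect w (B.erase z) z y fun ω => X (x :: loopErase ω)) := by
  rw [expect_eq_first_step hB hw x y (fun _ => hX _), if_neg hxy, if_neg hy, zero_add,
    loopErase_cons_of_notMem (by simpa using hxy), loopErase_cons_of_notMem (by simp),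
    loopErase_nil]
  congr 1
  refine sum_congr rfl fun z hz => ?_
  rw [← expect_loopErase_of_mem hB hw hz (by rintro rfl; exact hy hz)
    (X := fun η => X (x :: η)) fun _ => hX _]
  congr 1
  refine expect_congr fun ω hω => ?_
  rw [loopErase_cons_of_notMem]
  intro hxω
  rcases mem_of_mem_walks hω hxω with rfl | h | h
  · exact hx hz
  · exact hxy h
  · exact hx h

lemma mass_symm (hs : ∀ u v, w u v = w v u) (B : Finset Site) (x y : Site) :
    mass w B x y = mass w B y x := by
  let e : walks B x y ≃ walks B y x :=
    { toFun := fun ω => ⟨ω.1.reverse, reverse_mem_walks ω.2⟩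
      invFun := fun ω => ⟨ω.1.reverse, reverse_mem_walks ω.2⟩
      left_inv := fun ω => by simp
      right_inv := fun ω => by simp }
  unfold mass
  rw [← e.tsum_eq]
  exact tsum_congr fun ω => (pathWeight_reverse hs ω).symm

lemma mass_eq_mass_erase_mul (hB : B ⊆ A) (hw : ∀ u v, |w u v| ≤ srw A u v)
    (hs : ∀ u v, w u v = w v u) {u z : Site} (hz : z ∈ B) (hu : u ≠ z) :
    mass w B u z = mass w (B.erase z) u z * mass w B z z := by
  rw [mass_symm hs B u z, mass_mul_mass_erase hB hw hz hu, mass_symm hs _ z u, mul_comm]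

lemma eq_zero_of_eq_sum (hB : B ⊆ A) (hw : ∀ u v, |w u v| ≤ srw A u v) {f : Site → ℝ}
    (hf : ∀ u ∈ B, f u = ∑ v ∈ B, w u v * f v) : ∀ u ∈ B, f u = 0 := by
  refine eq_zero_of_abs_le_sum hB fun u hu => ?_
  rw [hf u hu]
  refine (abs_sum_le_sum_abs _ _).trans (sum_le_sum fun v _ => ?_)
  rw [abs_mul]
  exact mul_le_mul_of_nonneg_right (hw u v) (abs_nonneg _)

/-- Decomposition of the walks from `u` to `y` at the first visit to `z`. -/
lemma mass_eq_mass_erase_add (hB : B ⊆ A) (hw : ∀ u v, |w u v| ≤ srw A u v) {u y z : Site}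
    (hz : z ∈ B) (hu : u ≠ z) (hy : y ≠ z) :
    mass w B u y = mass w (B.erase z) u y + mass w (B.erase z) u z * mass w B z y := by
  have hB' : B.erase z ⊆ A := (erase_subset z B).trans hB
  -- Instead of cutting paths, let `f` be the defect of the identity. First-step equations make `f`
  -- satisfy the homogeneous equation away from `z`, so it vanishes on `B.erase z` by the maximum
  -- principle; one more step gives it at `u`, which may lie outside `B`.
  set f : Site → ℝ := fun u =>
    mass w B u y - mass w (B.erase z) u y - mass w (B.erase z) u z * mass w B z y with hf
  have hrec : ∀ u, u ≠ z → f u = ∑ v ∈ B.erase z, w u v * f v := by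
    intro u hu
    have h1 := mass_eq_first_step hB hw u y
    have h2 := mass_eq_first_step hB' hw u y
    have h3 := mass_eq_first_step hB' hw u z
    rw [← add_sum_erase B _ hz] at h1
    simp only [mem_erase, hy, ne_eq, not_false_eq_true, true_and] at h2
    simp only [hu, if_false, mem_erase, ne_eq, not_true_eq_false, false_and, zero_add] at h3
    simp only [hf, mul_sub, sum_sub_distrib]
    have h4 : ∑ v ∈ B.erase z, w u v * (mass w (B.erase z) v z * mass w B z y) =
        (∑ v ∈ B.erase z, w u v * mass w (B.erase z) v z) * mass w B z y := by
      rw [sum_mul]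
      exact sum_congr rfl fun _ _ => by ring
    rw [h4, h1, h2, h3]
    ring
  have h0 := eq_zero_of_eq_sum hB' hw fun u hu => hrec u (mem_erase.1 hu).1
  have : f u = 0 := by
    rw [hrec u hu]
    exact sum_eq_zero fun v hv => by rw [h0 v hv, mul_zero]
  simp only [hf] at this
  linarith

/-! ### Loop erasures are self-avoiding walks -/

lemma mem_of_mem_loopErase {ω : List Site} {z : Site} (h : z ∈ loopErase ω) : z ∈ ω := by
  induction ω using loopErase.induct with
  | case1 => simp at h
  | case2 x t ih =>
    rw [loopErase_cons, List.mem_cons] at h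
    rcases h with rfl | h
    · simp
    · exact List.mem_cons_of_mem _ ((List.rtakeWhile_suffix _ _).subset (ih h))

lemma nodup_loopErase (ω : List Site) : (loopErase ω).Nodup := by
  induction ω using loopErase.induct with
  | case1 => simp
  | case2 x t ih =>
    rw [loopErase_cons, List.nodup_cons]
    refine ⟨fun h => ?_, ih⟩
    simpa using List.mem_rtakeWhile_imp (mem_of_mem_loopErase h)

lemma head?_loopErase (ω : List Site) : (loopErase ω).head? = ω.head? := by
  cases ω with
  | nil => simp
  | cons x t => rw [loopErase_cons]; rfl

/-- The part kept by loop erasure, with `x` put in front, is a genuine suffix of the path. This is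
why adjacency and the final vertex survive erasure. -/
lemma cons_rtakeWhile_ne (x : Site) (t : List Site) :
    ∃ a, x :: t = a ++ x :: t.rtakeWhile fun z => z ≠ x := by
  obtain ⟨a, s, h, ha, hs, hr⟩ := rtakeWhile_ne_decomp (List.mem_cons_self (a := x) (l := t))
  have hs' : (t.rtakeWhile fun z => z ≠ x) = s := by
    cases a with
    | nil => simp at ha
    | cons u a =>
      rw [List.cons_append, List.cons.injEq] at h
      obtain ⟨rfl, rfl⟩ := h
      cases a with
      | nil =>
        rw [List.nil_append, List.rtakeWhile_eq_self_iff]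
        intro z hz
        simp only [ne_eq, decide_not, Bool.not_eq_eq_eq_not, Bool.not_true,
          decide_eq_false_iff_not]
        rintro rfl
        exact hs hz
      | cons v a => exact rtakeWhile_append_of_notMem (by simpa using ha) hs
  rw [hs']
  obtain ⟨a', rfl⟩ := List.getLast?_eq_some_iff.1 ha
  exact ⟨a', by rw [h]; simp⟩

lemma getLast?_loopErase (ω : List Site) : (loopErase ω).getLast? = ω.getLast? := by
  induction ω using loopErase.induct with
  | case1 => simp
  | case2 x t ih =>
    obtain ⟨a, ha⟩ := cons_rtakeWhile_ne x t
    rw [loopErase_cons, ha, List.getLast?_append, List.getLast?_cons, List.getLast?_cons, ih]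
    simp

lemma isChain_loopErase {ω : List Site} (h : ω.IsChain lattice.Adj) :
    (loopErase ω).IsChain lattice.Adj := by
  induction ω using loopErase.induct with
  | case1 => simp
  | case2 x t ih =>
    obtain ⟨a, ha⟩ := cons_rtakeWhile_ne x t
    rw [ha] at h
    have h' := h.right_of_append
    rw [loopErase_cons, List.isChain_cons, head?_loopErase]
    rw [List.isChain_cons] at h'
    exact ⟨h'.1, ih h'.2⟩

lemma loopErase_mem_saws {x y : Site} {ω : List Site} (h : ω ∈ walks B x y) :
    loopErase ω ∈ saws B x y := by
  have hnd := nodup_loopErase ω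
  have hh : (loopErase ω).head? = some x := by rw [head?_loopErase]; exact h.1
  have hl : (loopErase ω).getLast? = some y := by rw [getLast?_loopErase]; exact h.2.1
  refine ⟨⟨hh, hl, isChain_loopErase h.2.2.1, fun z hz => ?_⟩, hnd⟩
  have hzω : z ∈ loopErase ω := List.mem_of_mem_tail (List.mem_of_mem_dropLast hz)
  rcases mem_of_mem_walks h (mem_of_mem_loopErase hzω) with rfl | rfl | h
  · exfalso
    obtain ⟨t, ht⟩ := List.head?_eq_some_iff.1 hh
    rw [ht] at hz hnd
    exact (List.nodup_cons.1 hnd).1 (List.mem_of_mem_dropLast hz)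
  · exfalso
    obtain ⟨t, ht⟩ := List.getLast?_eq_some_iff.1 hl
    rw [ht] at hz hnd
    rw [← List.tail_dropLast, List.dropLast_concat] at hz
    have := List.disjoint_of_nodup_append hnd (List.mem_of_mem_tail hz)
    simp at this
  · exact h

/-! ### Fomin's identity for walks whose loop erasure uses a given edge -/

lemma abs_usesDirected_le (e : Site × Site) (ω : List Site) : |usesDirected e ω| ≤ 1 := by
  unfold usesDirected; split_ifs <;> simp

lemma expect_usesDirected_recursion (hB : B ⊆ A) (hw : ∀ u v, |w u v| ≤ srw A u v)
    {x y : Site} (hx : x ∉ B) (hy : y ∉ B) (hxy : x ≠ y) {e : Site × Site} (he : x ≠ e.1) :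
    expect w B x y (usesDirected e) =
      ∑ z ∈ B, w x z * (mass w B z z * expect w (B.erase z) z y (usesDirected e)) := by
  have h := expect_loopErase_recursion hB hw hx hy hxy
    (X := fun η => if e ∈ steps η then 1 else 0) fun η => by split_ifs <;> simp
  have hne : ∀ z, e ≠ (x, z) := by rintro z rfl; exact he rfl
  refine h.trans ?_
  rw [if_neg (by simp [hne]), mul_zero, zero_add]
  refine sum_congr rfl fun z _ => ?_
  congr 2
  refine expect_congr fun ω hω => ?_
  have hh := head?_loopErase ω
  rw [hω.1] at hh
  obtain ⟨t, ht⟩ := List.head?_eq_some_iff.1 hh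
  unfold usesDirected
  rw [ht]
  simp [hne]

/-- Since `a ∉ B`, the walk never returns to `a`, so its loop erasure uses `(a, b)` exactly when the
first step goes to `b`. -/
lemma expect_usesDirected_of_fst (hB : B ⊆ A) (hw : ∀ u v, |w u v| ≤ srw A u v)
    {a b y : Site} (ha : a ∉ B) (hb : b ∈ B) (hy : y ∉ B) (hay : a ≠ y) :
    expect w B a y (usesDirected (a, b)) = w a b * mass w B b y := by
  have h := expect_loopErase_recursion hB hw ha hy hay
    (X := fun η => if (a, b) ∈ steps η then 1 else 0) fun η => by split_ifs <;> simp
  have hby : b ≠ y := by rintro rfl; exact hy hb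
  refine h.trans ?_
  rw [if_neg (by simp [hby]), mul_zero, zero_add, sum_eq_single b]
  · rw [mass_mul_mass_erase hB hw hb hby.symm, mass_eq_expect w (B.erase b)]
    congr 2
    refine expect_congr fun ω hω => ?_
    have hh := head?_loopErase ω
    rw [hω.1] at hh
    obtain ⟨t, ht⟩ := List.head?_eq_some_iff.1 hh
    rw [ht]
    simp
  · intro z hz hzb
    have : expect w (B.erase z) z y (fun ω => if (a, b) ∈ steps (a :: loopErase ω) then 1 else 0) =
        expect w (B.erase z) z y fun _ => 0 := by
      refine expect_congr fun ω hω => if_neg ?_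
      have hh := head?_loopErase ω
      rw [hω.1] at hh
      obtain ⟨t, ht⟩ := List.head?_eq_some_iff.1 hh
      rw [ht, steps_cons_cons, ← ht, List.mem_cons]
      rintro (h | h)
      · exact hzb (by simpa using h.symm)
      · have ha' := mem_of_mem_loopErase (mem_of_mem_steps h).1
        rcases mem_of_mem_walks hω ha' with rfl | h | h
        · exact ha hz
        · exact hay h
        · exact ha (mem_of_mem_erase h)
    rw [this]
    simp [expect]
  · exact fun h => absurd hb h

/-- The loop erasure starts at `b` and is self-avoiding, so no edge of it enters `b`. -/
lemma expect_usesDirected_of_snd (w : Site → Site → ℝ) (B : Finset Site) (a b y : Site) :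
    expect w B b y (usesDirected (a, b)) = 0 := by
  have : expect w B b y (usesDirected (a, b)) = expect w B b y fun _ => 0 := by
    refine expect_congr fun ω hω => if_neg fun h => ?_
    have hh := head?_loopErase ω
    rw [hω.1] at hh
    obtain ⟨t, ht⟩ := List.head?_eq_some_iff.1 hh
    have hnd := nodup_loopErase ω
    rw [ht] at h hnd
    exact (List.nodup_cons.1 hnd).1 (snd_mem_tail_of_mem_steps h)
  rw [this]
  simp [expect]

/-- The `2 × 2` determinant of masses is multiplied by `G_B(a, a)` when `a` is put back. -/
lemma mass_det_erase (hB : B ⊆ A) (hw : ∀ u v, |w u v| ≤ srw A u v)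
    (hs : ∀ u v, w u v = w v u) {a b x y : Site} (ha : a ∈ B) (hx : x ≠ a) (hb : b ≠ a)
    (hy : y ≠ a) :
    mass w B x a * mass w B b y - mass w B x b * mass w B a y =
      mass w B a a * (mass w (B.erase a) x a * mass w (B.erase a) b y -
        mass w (B.erase a) x b * mass w (B.erase a) a y) := by
  rw [mass_eq_mass_erase_mul hB hw hs ha hx, mass_eq_mass_erase_add hB hw ha hb hy,
    mass_eq_mass_erase_add hB hw ha hx hb, mass_mul_mass_erase hB hw ha hb,
    mass_mul_mass_erase hB hw ha hy, mass_symm hs (B.erase a) a b]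
  ring

/-- The corresponding identity for a point `z` that is erased at the start of the walk. -/
lemma mass_det_erase_start (hB : B ⊆ A) (hw : ∀ u v, |w u v| ≤ srw A u v)
    (hs : ∀ u v, w u v = w v u) {a b z y : Site} (hz : z ∈ B) (ha : a ≠ z) (hb : b ≠ z)
    (hy : y ≠ z) :
    mass w B z a * mass w B b y - mass w B z b * mass w B a y =
      mass w B z z * (mass w (B.erase z) z a * mass w (B.erase z) b y -
        mass w (B.erase z) z b * mass w (B.erase z) a y) := by
  rw [mass_eq_mass_erase_add hB hw hz ha hy, mass_eq_mass_erase_add hB hw hz hb hy,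
    mass_mul_mass_erase hB hw hz ha, mass_mul_mass_erase hB hw hz hb,
    mass_symm hs (B.erase z) a z, mass_symm hs (B.erase z) b z]
  ring

/-- The subtracted product accounts for the walks from `b` to `y` that visit `a`. This settles the
cases of Fomin's identity in which the walk first steps onto an end of the edge. -/
lemma mass_det_endpoint (hB : B ⊆ A) (hw : ∀ u v, |w u v| ≤ srw A u v)
    (hs : ∀ u v, w u v = w v u) {a b y : Site} (ha : a ∈ B) (hb : b ≠ a) (hy : y ≠ a) :
    mass w B a a * mass w B b y - mass w B a b * mass w B a y =
      mass w B a a * mass w (B.erase a) b y := by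
  rw [mass_eq_mass_erase_add hB hw ha hb hy, mass_mul_mass_erase hB hw ha hb,
    mass_symm hs (B.erase a) a b]
  ring

/-- Fomin's identity for one edge, by induction on the domain rather than by a path-switching
involution. Both sides are linear in the first step from `x`. After a step to `z` the loop erasure
never revisits `z`, so both sides shed the factor `G_B(z, z)` and continue from `z` in `B.erase z`.
The induction ends when `z` is `a` or `b`. -/
theorem expect_usesDirected_sub (hB : B ⊆ A) (hw : ∀ u v, |w u v| ≤ srw A u v)
    (hs : ∀ u v, w u v = w v u) {a b x y : Site} (hab : a ≠ b) (ha : a ∈ B) (hb : b ∈ B)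
    (hx : x ∉ B) (hy : y ∉ B) (hxy : x ≠ y) :
    expect w B x y (usesDirected (a, b)) - expect w B x y (usesDirected (b, a)) =
      w a b * (mass w B x a * mass w B b y - mass w B x b * mass w B a y) := by
  induction B using Finset.strongInduction generalizing x with
  | H B ih =>
    have hxa : x ≠ a := by rintro rfl; exact hx ha
    have hxb : x ≠ b := by rintro rfl; exact hx hb
    have hya : y ≠ a := by rintro rfl; exact hy ha
    have hyb : y ≠ b := by rintro rfl; exact hy hb
    rw [expect_usesDirected_recursion hB hw hx hy hxy hxa,
      expect_usesDirected_recursion hB hw hx hy hxy hxb, mass_eq_first_step hB hw x a,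
      mass_eq_first_step hB hw x b, if_neg hxa, if_neg hxb, if_pos ha, if_pos hb, zero_add,
      zero_add, zero_add, sum_mul, sum_mul, ← sum_sub_distrib, ← sum_sub_distrib, mul_sum]
    refine sum_congr rfl fun z hz => ?_
    have hzy : z ≠ y := by rintro rfl; exact hy hz
    have hB' : B.erase z ⊆ A := (erase_subset z B).trans hB
    have hz' : z ∉ B.erase z := notMem_erase z B
    have hy' : y ∉ B.erase z := fun h => hy (mem_of_mem_erase h)
    suffices mass w B z z * (expect w (B.erase z) z y (usesDirected (a, b)) -
        expect w (B.erase z) z y (usesDirected (b, a))) =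
        w a b * (mass w B z a * mass w B b y - mass w B z b * mass w B a y) by
      linear_combination w x z * this
    by_cases hza : z = a
    · subst hza
      rw [expect_usesDirected_of_fst hB' hw hz' (mem_erase.2 ⟨hab.symm, hb⟩) hy' hzy,
        expect_usesDirected_of_snd, mass_det_endpoint hB hw hs ha hab.symm hya]
      ring
    by_cases hzb : z = b
    · subst hzb
      rw [expect_usesDirected_of_fst hB' hw hz' (mem_erase.2 ⟨hab, ha⟩) hy' hzy,
        expect_usesDirected_of_snd, hs z a]
      linear_combination w a z * mass_det_endpoint hB hw hs hb hab hyb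
    · rw [ih (B.erase z) (erase_ssubset hz) hB' (mem_erase.2 ⟨Ne.symm hza, ha⟩)
        (mem_erase.2 ⟨Ne.symm hzb, hb⟩) hz' hy' hzy,
        mass_det_erase_start hB hw hs hz (Ne.symm hza) (Ne.symm hzb) hzy.symm]
      ring

/-- The signed total mass of the walks whose loop erasure uses the edge `{a, b}` as a product of
the weight of the edge, a loop term and a determinant of Poisson kernels. -/
theorem expect_usesDirected_sub_eq_kernelDet (hw : ∀ u v, |w u v| ≤ srw A u v)
    (hs : ∀ u v, w u v = w v u) {a b x y : Site} (hab : a ≠ b) (ha : a ∈ A) (hb : b ∈ A)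
    (hx : x ∉ A) (hy : y ∉ A) (hxy : x ≠ y) :
    (expect w A x y fun ω => usesDirected (a, b) ω - usesDirected (b, a) ω) =
      w a b * loopFactor w [a, b] A * kernelDet w (A \ {a, b}) x y a b := by
  have hxa : x ≠ a := by rintro rfl; exact hx ha
  have hxb : x ≠ b := by rintro rfl; exact hx hb
  have hya : y ≠ a := by rintro rfl; exact hy ha
  have hyb : y ≠ b := by rintro rfl; exact hy hb
  have hsub : (expect w A x y fun ω => usesDirected (a, b) ω - usesDirected (b, a) ω) =
      expect w A x y (usesDirected (a, b)) - expect w A x y (usesDirected (b, a)) := by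
    unfold expect
    rw [← Summable.tsum_sub]
    · exact tsum_congr fun ω => sub_mul _ _ _
    · exact summable_mul_pathWeight subset_rfl hw x y (abs_usesDirected_le _)
    · exact summable_mul_pathWeight subset_rfl hw x y (abs_usesDirected_le _)
  have hA' : A.erase a ⊆ A := erase_subset a A
  have hA : A \ {a, b} = (A.erase a).erase b := by
    ext z; simp only [mem_sdiff, mem_insert, mem_singleton, mem_erase]; tauto
  -- The two Green's functions of `loopFactor` come out one at a time, first for `a` in `A`, then
  -- for `b` in `A.erase a`. In `h2` the roles of `a` and `b` are exchanged, which accounts for the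
  -- minus sign at the end.
  have h1 := mass_det_erase subset_rfl hw hs ha hxa hab.symm hya
  have h2 := mass_det_erase hA' hw hs (mem_erase.2 ⟨hab.symm, hb⟩) hxb hab hyb
  rw [hsub, expect_usesDirected_sub subset_rfl hw hs hab ha hb hx hy hxy, h1, hA]
  simp only [loopFactor, kernelDet]
  rw [mass_symm hs _ y a, mass_symm hs _ y b]
  linear_combination -w a b * mass w A a a * h2

/-! ### Loop terms as ratios of determinants -/

/-- The weights out of points of `B`, as a matrix indexed by `A`. -/
def rowKilled (w : Site → Site → ℝ) (A B : Finset Site) : Matrix A A ℝ :=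
  Matrix.of fun u v => if u.1 ∈ B then w u v else 0

/-- The weights between points of `B`, as a matrix indexed by `A`. -/
def killed (w : Site → Site → ℝ) (A B : Finset Site) : Matrix A A ℝ :=
  Matrix.of fun u v => if u.1 ∈ B ∧ v.1 ∈ B then w u v else 0

/-- The determinant of the Laplacian on `B`. -/
noncomputable def lapDet (w : Site → Site → ℝ) (A B : Finset Site) : ℝ :=
  (1 - rowKilled w A B).det

lemma sum_coe_ite_mem (hB : B ⊆ A) (f : Site → ℝ) :
    ∑ z : A, (if z.1 ∈ B then f z else 0) = ∑ z ∈ B, f z := by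
  rw [sum_coe_sort A fun z => if z ∈ B then f z else 0, sum_ite_mem, inter_eq_right.2 hB]

/-- An instance of `det(1 - MD) = det(1 - DM)` with `D` the projection onto `B`. The row version
suits Cramer's rule; the symmetric one has real eigenvalues and its traces count loops in `B`. -/
lemma lapDet_eq (w : Site → Site → ℝ) (A B : Finset Site) :
    lapDet w A B = (1 - killed w A B).det := by
  have h1 : rowKilled w A B =
      Matrix.diagonal (fun u : A => if u.1 ∈ B then (1 : ℝ) else 0) * rowKilled w A B := by
    ext u v
    by_cases hu : u.1 ∈ B <;> simp [rowKilled, Matrix.diagonal_mul, hu]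
  have h2 : killed w A B =
      rowKilled w A B * Matrix.diagonal (fun u : A => if u.1 ∈ B then (1 : ℝ) else 0) := by
    ext u v
    simp only [killed, rowKilled, Matrix.mul_diagonal, Matrix.of_apply]
    by_cases hu : u.1 ∈ B <;> by_cases hv : v.1 ∈ B <;> simp [hu, hv]
  rw [lapDet, h1, Matrix.det_one_sub_mul_comm, ← h2]

/-- Cramer's rule: the column `G_B(·, z)`, extended by zero, solves `(1 - w) g = δ_z`. -/
lemma mass_self_mul_lapDet (hB : B ⊆ A) (hw : ∀ u v, |w u v| ≤ srw A u v) {z : Site}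
    (hz : z ∈ B) : mass w B z z * lapDet w A B = lapDet w A (B.erase z) := by
  set M := 1 - rowKilled w A B with hM
  set g : A → ℝ := fun u => if u.1 ∈ B then mass w B u z else 0 with hg
  set z' : A := ⟨z, hB hz⟩ with hz'
  have h1 : M.mulVec g = Pi.single z' 1 := by
    ext u
    rw [hM, Matrix.sub_mulVec, Matrix.one_mulVec, Pi.sub_apply]
    have hsum : (rowKilled w A B).mulVec g u =
        if u.1 ∈ B then ∑ v ∈ B, w u v * mass w B v z else 0 := by
      simp only [Matrix.mulVec, dotProduct, rowKilled, Matrix.of_apply, hg]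
      by_cases hu : u.1 ∈ B
      · simp only [hu, if_true, mul_ite, mul_zero]
        exact sum_coe_ite_mem hB fun v => w u v * mass w B v z
      · simp [hu]
    rw [hsum, hg]
    have hiff : u = z' ↔ u.1 = z := Subtype.ext_iff
    by_cases hu : u.1 ∈ B
    · simp only [hu, if_true]
      rw [mass_eq_first_step hB hw, if_pos hz, Pi.single_apply]
      simp only [hiff]
      ring
    · have : u ≠ z' := fun h => hu (by rw [hiff.1 h]; exact hz)
      simp [hu, this]
  -- The diagonal entry of the adjugate at `z` is the determinant with row `z` replaced by `δ_z`,
  -- which is the Laplacian with `z` removed from the domain.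
  have h2 := congrFun (congrArg M.adjugate.mulVec h1) z'
  rw [Matrix.mulVec_mulVec, Matrix.adjugate_mul, Matrix.smul_mulVec, Matrix.one_mulVec,
    Matrix.mulVec_single_one, Matrix.col_apply, Matrix.adjugate_apply] at h2
  have h3 : M.updateRow z' (Pi.single z' 1) = 1 - rowKilled w A (B.erase z) := by
    ext u v
    rw [Matrix.updateRow_apply]
    have hiff : u = z' ↔ u.1 = z := Subtype.ext_iff
    by_cases hu : u = z'
    · subst hu
      simp [rowKilled, hz', Matrix.one_apply, Pi.single_apply, eq_comm]
    · rw [if_neg hu]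
      simp [hM, rowKilled, hiff.not.1 hu]
  rw [h3] at h2
  simp only [Pi.smul_apply, smul_eq_mul, hg, hz', hz, if_true] at h2
  rw [lapDet, lapDet, ← h2, mul_comm]

lemma loopErasedMeasure_eq_expect (w : Site → Site → ℝ) (B : Finset Site) (x y : Site)
    (η : List Site) : loopErasedMeasure w B x y η =
      expect w B x y fun ω => if loopErase ω = η then 1 else 0 := by
  unfold loopErasedMeasure expect
  have h1 := tsum_subtype {ω : List Site | ω ∈ walks B x y ∧ loopErase ω = η} (pathWeight w)
  have h2 := tsum_subtype (walks B x y) fun ω =>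
    (if loopErase ω = η then 1 else 0) * pathWeight w ω
  refine h1.trans (Eq.trans (tsum_congr fun ω => ?_) h2.symm)
  by_cases h : ω ∈ walks B x y <;> by_cases h' : loopErase ω = η <;> simp [Set.indicator, h, h']

/-- Each vertex of `η` in `B` contributes a Green's function on what is left of the domain, hence a
ratio of successive determinants; the product telescopes. -/
theorem loopErasedMeasure_mul_lapDet (hB : B ⊆ A) (hw : ∀ u v, |w u v| ≤ srw A u v)
    {x y : Site} (hx : x ∉ B) (hy : y ∉ B) (hxy : x ≠ y) {η : List Site} (hη : η ∈ saws B x y) :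
    loopErasedMeasure w B x y η * lapDet w A B =
      pathWeight w η * lapDet w A (B \ η.toFinset) := by
  induction η generalizing B x with
  | nil => exact absurd hη.1 (nil_notMem_walks _ _ _)
  | cons u η ih =>
    obtain rfl := head_eq_of_cons_mem_walks hη.1
    obtain ⟨hη, hnd⟩ := hη
    cases η with
    | nil => simp at hη; exact absurd hη hxy
    | cons v t =>
      have hrec := expect_loopErase_recursion hB hw hx hy hxy
        (X := fun η' => if η' = u :: v :: t then 1 else 0) fun η => by split_ifs <;> simp
      rw [cons_cons_mem_walks] at hη
      obtain ⟨-, -, hvt, hv⟩ := hη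
      rw [loopErasedMeasure_eq_expect, hrec]
      have hhead : ∀ z, ∀ ω ∈ walks (B.erase z) z y, (loopErase ω).head? = some z := by
        intro z ω hω
        rw [head?_loopErase]; exact hω.1
      -- Erasure keeps the first vertex, so only a first step to `v` can produce `η`.
      have hzero : ∀ z, z ≠ v → (expect w (B.erase z) z y fun ω =>
          if u :: loopErase ω = u :: v :: t then 1 else 0) = 0 := by
        intro z hz
        rw [expect_congr (Y := fun _ => 0)]
        · simp [expect]
        · intro ω hω
          refine if_neg fun h => hz ?_
          rw [List.cons.injEq] at h
          have := hhead z ω hω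
          rw [h.2] at this
          simpa using this.symm
      rw [List.nodup_cons] at hnd
      by_cases hvB : v ∈ B
      · have hvy : v ≠ y := by rintro rfl; exact hy hvB
        have hmem : v :: t ∈ saws (B.erase v) v y :=
          ⟨mem_walks_erase hvt (List.nodup_cons.1 hnd.2).1, hnd.2⟩
        have hIH := ih ((erase_subset v B).trans hB) (notMem_erase v B)
          (fun h => hy (mem_of_mem_erase h)) hvy hmem
        rw [if_neg (by simpa using fun h => absurd h.symm hvy), mul_zero, zero_add,
          sum_eq_single v (fun z _ hz => by rw [hzero z hz]; ring) (fun h => absurd hvB h)]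
        have : (expect w (B.erase v) v y fun ω =>
            if u :: loopErase ω = u :: v :: t then 1 else 0) =
            loopErasedMeasure w (B.erase v) v y (v :: t) := by
          rw [loopErasedMeasure_eq_expect]
          simp
        have hset : B.erase v \ (v :: t).toFinset = B \ (u :: v :: t).toFinset := by
          ext z
          simp only [mem_sdiff, mem_erase, List.mem_toFinset, List.mem_cons]
          constructor
          · rintro ⟨⟨h1, h2⟩, h3⟩
            refine ⟨h2, ?_⟩
            rintro (rfl | h)
            · exact hx h2
            · exact h3 h
          · rintro ⟨h1, h2⟩
            tauto
        rw [this, pathWeight_cons_cons, ← hset]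
        rw [← mass_self_mul_lapDet hB hw hvB] at hIH
        linear_combination w u v * hIH
      · obtain rfl : t = [] := hv.resolve_right hvB
        obtain rfl : v = y := by simpa using hvt
        have hset : B \ [u, v].toFinset = B := by
          rw [Finset.sdiff_eq_self_iff_disjoint]
          simp [hx, hy]
        rw [sum_eq_zero fun z hz => by
          rw [hzero z (by rintro rfl; exact hvB hz)]; ring, hset]
        simp

/-! ### Loop measures and determinants -/

lemma isHermitian_killed (hs : ∀ u v, w u v = w v u) (A B : Finset Site) :
    (killed w A B).IsHermitian := by
  ext u v
  simp [killed, hs v.1 u.1, and_comm]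

/-- An eigenvector with `|c| ≥ 1` would vanish on `B` by the maximum principle, and off `B` because
its row is zero while `c ≠ 0`. -/
lemma abs_eigenvalues_killed_lt_one (hB : B ⊆ A) (hw : ∀ u v, |w u v| ≤ srw A u v)
    (hs : ∀ u v, w u v = w v u) (i : A) : |(isHermitian_killed hs A B).eigenvalues i| < 1 := by
  by_contra! hge
  set hH := isHermitian_killed hs A B
  set c := hH.eigenvalues i
  set v : A → ℝ := (hH.eigenvectorBasis i).ofLp with hv
  have hev : (killed w A B).mulVec v = c • v := hH.mulVec_eigenvectorBasis i
  set f : Site → ℝ := fun u => if h : u ∈ A then v ⟨u, h⟩ else 0 with hf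
  have hfv : ∀ u : A, f u = v u := fun u => by simp [hf]
  have hmul : ∀ u : A, (killed w A B).mulVec v u =
      if u.1 ∈ B then ∑ z ∈ B, w u z * f z else 0 := by
    intro u
    simp only [Matrix.mulVec, dotProduct, killed, Matrix.of_apply]
    by_cases hu : u.1 ∈ B
    · simp only [hu, true_and, if_true, ite_mul, zero_mul, ← hfv]
      exact sum_coe_ite_mem hB fun z => w u z * f z
    · simp [hu]
  have h0 : ∀ u ∈ B, f u = 0 := by
    refine eq_zero_of_abs_le_sum hB fun u hu => ?_
    have h1 := congrFun hev ⟨u, hB hu⟩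
    rw [hmul, if_pos hu, Pi.smul_apply, smul_eq_mul, ← hfv] at h1
    calc |f u| ≤ |c| * |f u| := le_mul_of_one_le_left (abs_nonneg _) hge
      _ = |∑ z ∈ B, w u z * f z| := by rw [← abs_mul, ← h1]
      _ ≤ ∑ z ∈ B, |w u z * f z| := abs_sum_le_sum_abs _ _
      _ ≤ ∑ z ∈ B, srw A u z * |f z| := sum_le_sum fun z _ => by
          rw [abs_mul]; exact mul_le_mul_of_nonneg_right (hw u z) (abs_nonneg _)
  have hv0 : v = 0 := by
    ext u
    by_cases hu : u.1 ∈ B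
    · rw [← hfv, h0 _ hu]; rfl
    · have h1 := congrFun hev u
      rw [hmul, if_neg hu, Pi.smul_apply, smul_eq_mul] at h1
      refine (mul_eq_zero.1 h1.symm).resolve_left fun hc => ?_
      rw [hc, abs_zero] at hge
      linarith
  apply hH.eigenvectorBasis.orthonormal.ne_zero i
  ext u
  exact congrFun hv0 u

lemma trace_pow_eq_sum_eigenvalues {n : Type*} [Fintype n] [DecidableEq n] {S : Matrix n n ℝ}
    (hS : S.IsHermitian) (k : ℕ) : (S ^ k).trace = ∑ i, hS.eigenvalues i ^ k := by
  conv_lhs => rw [hS.spectral_theorem, ← map_pow, Unitary.conjStarAlgAut_apply,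
    Matrix.trace_mul_cycle, Unitary.coe_star_mul_self, one_mul, Matrix.diagonal_pow,
    Matrix.trace_diagonal]
  simp

lemma det_one_sub_eq_prod_eigenvalues {n : Type*} [Fintype n] [DecidableEq n]
    {S : Matrix n n ℝ} (hS : S.IsHermitian) : (1 - S).det = ∏ i, (1 - hS.eigenvalues i) := by
  have h := congrArg (Polynomial.eval 1) hS.charpoly_eq
  rw [Matrix.eval_charpoly, Polynomial.eval_prod] at h
  simpa using h

lemma hasSum_trace_pow_div {n : Type*} [Fintype n] [DecidableEq n] {S : Matrix n n ℝ}
    (hS : S.IsHermitian) (h : ∀ i, |hS.eigenvalues i| < 1) :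
    0 < (1 - S).det ∧
      HasSum (fun k : ℕ => (S ^ k).trace / k) (-Real.log (1 - S).det) := by
  have hpos : ∀ i, 0 < 1 - hS.eigenvalues i := fun i => by linarith [(abs_lt.1 (h i)).2]
  rw [det_one_sub_eq_prod_eigenvalues hS]
  refine ⟨prod_pos fun i _ => hpos i, ?_⟩
  rw [Real.log_prod fun i _ => (hpos i).ne', ← sum_neg_distrib]
  have h1 : ∀ i ∈ (univ : Finset n), HasSum (fun k : ℕ => hS.eigenvalues i ^ k / k)
      (-Real.log (1 - hS.eigenvalues i)) := fun i _ => by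
    -- The term `k = 0` is a division by zero, hence 0, so the logarithm series starting at 1 is the
    -- full sum.
    rw [← hasSum_nat_add_iff' 1]
    simpa using Real.hasSum_pow_div_log_of_abs_lt_one (h i)
  convert hasSum_sum h1 using 2 with k
  rw [trace_pow_eq_sum_eigenvalues hS, sum_div]

/-- The lists of given length with entries in `B`. -/
def listsOf (B : Finset Site) : ℕ → Finset (List Site)
  | 0 => {[]}
  | n + 1 => (B ×ˢ listsOf B n).map
      ⟨fun p => p.1 :: p.2, fun p q h => by
        rw [List.cons.injEq] at h; exact Prod.ext h.1 h.2⟩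

lemma mem_listsOf {n : ℕ} {l : List Site} :
    l ∈ listsOf B n ↔ l.length = n ∧ ∀ z ∈ l, z ∈ B := by
  induction n generalizing l with
  | zero =>
    simp only [listsOf, mem_singleton, List.length_eq_zero_iff]
    constructor
    · rintro rfl; simp
    · exact fun h => h.1
  | succ n ih =>
    simp only [listsOf, mem_map, mem_product, ih]
    constructor
    · rintro ⟨⟨u, t⟩, ⟨h1, h2, h3⟩, rfl⟩
      exact ⟨congrArg Nat.succ h2, List.forall_mem_cons.2 ⟨h1, h3⟩⟩
    · rintro ⟨h1, h2⟩
      cases l with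
      | nil => simp at h1
      | cons u t => exact ⟨(u, t), by simp_all, rfl⟩

lemma sum_listsOf_succ (B : Finset Site) (n : ℕ) (f : List Site → ℝ) :
    ∑ l ∈ listsOf B (n + 1), f l = ∑ z ∈ B, ∑ l ∈ listsOf B n, f (z :: l) := by
  rw [listsOf, sum_map, sum_product]
  rfl

lemma killed_pow_succ_apply (hB : B ⊆ A) (w : Site → Site → ℝ) (n : ℕ) (u v : A) :
    (killed w A B ^ (n + 1)) u v =
      if u.1 ∈ B ∧ v.1 ∈ B then ∑ l ∈ listsOf B n, pathWeight w (u :: (l ++ [v.1])) else 0 := by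
  induction n generalizing u with
  | zero => simp [killed, listsOf]
  | succ n ih =>
    rw [pow_succ', Matrix.mul_apply]
    simp only [ih]
    by_cases hv : v.1 ∈ B
    · by_cases hu : u.1 ∈ B
      · simp only [killed, Matrix.of_apply, hu, hv, true_and, and_true, if_true, ite_mul,
          zero_mul, mul_ite, mul_zero]
        have h1 : ∀ z : A, (if z.1 ∈ B then (if z.1 ∈ B then
            w u z * ∑ l ∈ listsOf B n, pathWeight w (z :: (l ++ [v.1])) else 0) else 0) =
            if z.1 ∈ B then w u z * ∑ l ∈ listsOf B n, pathWeight w (z :: (l ++ [v.1])) else 0 :=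
          fun z => by split_ifs <;> rfl
        simp only [h1]
        rw [sum_coe_ite_mem hB fun z =>
          w u z * ∑ l ∈ listsOf B n, pathWeight w (z :: (l ++ [v.1])), sum_listsOf_succ]
        refine sum_congr rfl fun z _ => ?_
        rw [mul_sum]
        rfl
      · simp [killed, hu]
    · simp [hv]

lemma trace_killed_pow (hB : B ⊆ A) (w : Site → Site → ℝ) {n : ℕ} (hn : n ≠ 0) :
    (killed w A B ^ n).trace = ∑ l ∈ listsOf B n, pathWeight w (closeUp l) := by
  obtain ⟨n, rfl⟩ := Nat.exists_eq_succ_of_ne_zero hn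
  rw [Matrix.trace, sum_listsOf_succ]
  simp only [Matrix.diag_apply, killed_pow_succ_apply hB, and_self]
  rw [sum_coe_ite_mem hB fun z => ∑ l ∈ listsOf B n, pathWeight w (z :: (l ++ [z]))]
  rfl

lemma tsum_length_eq (w : Site → Site → ℝ) (B : Finset Site) (n : ℕ) :
    ∑' l : {l : List Site | l.length = n}, (if ∀ z ∈ l.1, z ∈ B then
      pathWeight w (closeUp l.1) / l.1.length else 0) =
      ∑ l ∈ listsOf B n, pathWeight w (closeUp l) / n := by
  classical
  rw [tsum_subtype {l : List Site | l.length = n} fun l => if ∀ z ∈ l, z ∈ B then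
      pathWeight w (closeUp l) / l.length else 0, tsum_eq_sum (s := listsOf B n)]
  · refine sum_congr rfl fun l hl => ?_
    rw [mem_listsOf] at hl
    rw [Set.indicator_of_mem (by exact hl.1), if_pos hl.2, hl.1]
  · intro l hl
    rw [mem_listsOf, not_and_or] at hl
    by_cases h : l.length = n
    · rw [Set.indicator_of_mem (by exact h), if_neg (hl.resolve_left (by simpa using h))]
    · apply Set.indicator_of_notMem
      exact h

/-- The total mass of the rooted loop measure on `B` is minus the logarithm of the determinant. -/
theorem hasSum_rootedLoops (hB : B ⊆ A) (hw : ∀ u v, |w u v| ≤ srw A u v)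
    (hs : ∀ u v, w u v = w v u) :
    0 < lapDet w A B ∧ HasSum (fun l : List Site => if ∀ z ∈ l, z ∈ B then
      pathWeight w (closeUp l) / l.length else 0) (-Real.log (lapDet w A B)) := by
  -- For the nonnegative weight `srw A`, grouping by length reduces summability to that of the
  -- traces; this then dominates the series for `w`.
  have hsum : Summable fun l : List Site => if ∀ z ∈ l, z ∈ B then
      pathWeight (srw A) (closeUp l) / l.length else 0 := by
    have h0 : 0 ≤ fun l : List Site => if ∀ z ∈ l, z ∈ B then
        pathWeight (srw A) (closeUp l) / l.length else 0 := fun l => by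
      have := pathWeight_nonneg (srw_nonneg A) (closeUp l)
      simp only [Pi.zero_apply]
      split_ifs <;> positivity
    rw [summable_partition h0 (s := fun n => {l | l.length = n}) fun l => ⟨l.length, by simp⟩]
    constructor
    · intro n
      refine summable_of_hasFiniteSupport ((listsOf B n).finite_toSet.preimage
        Subtype.val_injective.injOn |>.subset fun l hl => ?_)
      simp only [Function.mem_support, ne_eq, ite_eq_right_iff, Classical.not_imp] at hl
      exact mem_coe.2 (mem_listsOf.2 ⟨l.2, hl.1⟩)
    · have h1 := (hasSum_trace_pow_div (isHermitian_killed (srw_symm A) A B)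
        (abs_eigenvalues_killed_lt_one hB (fun u v => (abs_of_nonneg (srw_nonneg A u v)).le)
          (srw_symm A))).2.summable
      refine h1.congr fun n => ?_
      rw [tsum_length_eq, ← sum_div]
      rcases eq_or_ne n 0 with rfl | hn
      · simp
      · rw [trace_killed_pow hB _ hn]
  have hsum' : Summable fun l : List Site => if ∀ z ∈ l, z ∈ B then
      pathWeight w (closeUp l) / l.length else 0 := by
    refine Summable.of_norm_bounded hsum fun l => ?_
    split_ifs
    · rw [norm_div, Real.norm_eq_abs, pathWeight_abs, Real.norm_natCast]
      gcongr
      exact pathWeight_mono (fun u v => abs_nonneg (w u v)) hw _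
    · simp
  obtain ⟨hpos, h2⟩ := hasSum_trace_pow_div (isHermitian_killed hs A B)
    (abs_eigenvalues_killed_lt_one hB hw hs)
  rw [lapDet_eq]
  refine ⟨hpos, ?_⟩
  have h3 := hsum'.hasSum.tsum_fiberwise List.length
  have h4 : (fun k : ℕ => (killed w A B ^ k).trace / k) = fun n =>
      ∑' l : (List.length ⁻¹' {n} : Set (List Site)), (if ∀ z ∈ l.1, z ∈ B then
        pathWeight w (closeUp l.1) / l.1.length else 0) := by
    funext n
    refine Eq.trans ?_ (tsum_length_eq w B n).symm
    rw [← sum_div]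
    -- At length 0 the trace is the cardinality of `A` and the empty list has weight 1, but both are
    -- divided by 0.
    rcases eq_or_ne n 0 with rfl | hn
    · simp
    · rw [trace_killed_pow hB _ hn]
  rw [h4] at h2
  rw [← h3.unique h2]
  exact hsum'.hasSum

/-! ### The sign of the zipper -/

open Classical in
/-- The sign of an edge: `-1` on the zipper. -/
noncomputable def zipperSign (A : Finset Site) (u v : Site) : ℝ :=
  if CrossesZipper A u v then -1 else 1

lemma pathWeight_zipperWeight (A : Finset Site) (ω : List Site) :
    pathWeight (zipperWeight A) ω = pathWeight (zipperSign A) ω * pathWeight (srw A) ω :=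
  pathWeight_mul _ _ ω

lemma pathWeight_zipperSign (A : Finset Site) (ω : List Site) :
    pathWeight (zipperSign A) ω = (-1) ^ crossings A ω := by
  classical
  induction ω with
  | nil => simp [crossings]
  | cons u ω ih =>
    cases ω with
    | nil => simp [crossings]
    | cons v ω =>
      rw [pathWeight_cons_cons, ih]
      unfold crossings zipperSign
      rw [steps_cons_cons, List.countP_cons]
      by_cases h : CrossesZipper A u v <;> simp [h, pow_succ]

lemma crossesZipper_symm {u v : Site} (h : CrossesZipper A u v) : CrossesZipper A v u := by
  obtain ⟨j, h1, h2, h3⟩ := h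
  exact ⟨j, h1, h2, by tauto⟩

lemma zipperWeight_symm (A : Finset Site) (u v : Site) :
    zipperWeight A u v = zipperWeight A v u := by
  have h : CrossesZipper A u v ↔ CrossesZipper A v u := ⟨crossesZipper_symm, crossesZipper_symm⟩
  unfold zipperWeight
  rw [srw_symm]
  split_ifs <;> tauto

lemma abs_zipperWeight_le (A : Finset Site) (u v : Site) : |zipperWeight A u v| ≤ srw A u v := by
  unfold zipperWeight
  split_ifs <;> simp [abs_of_nonneg (srw_nonneg A u v)]

/-! ### Winding parity of a loop around a lattice point -/

/-- The sign of an edge: `-1` if it crosses the downward vertical ray that starts in the face to the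
lower right of `v`. -/
def raySign (v u u' : Site) : ℝ :=
  if u.2 = u'.2 ∧ u.2 < v.2 ∧ ((u.1 = v.1 ∧ u'.1 = v.1 + 1) ∨ (u.1 = v.1 + 1 ∧ u'.1 = v.1))
  then -1 else 1

/-- The parity, as a sign, of the winding number of a loop around the face to the lower right
of `v`. -/
noncomputable def windingSign (l : List Site) (v : Site) : ℝ := pathWeight (raySign v) (closeUp l)

lemma mem_closeUp {l : List Site} {z : Site} : z ∈ closeUp l ↔ z ∈ l := by
  rw [closeUp, List.mem_append]
  exact ⟨fun h => h.elim id List.mem_of_mem_take, Or.inl⟩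

/-- Interior factors occur in pairs and cancel, so on closed paths a sign of this form is trivial.
This allows the ray that defines the winding parity to be moved. -/
lemma pathWeight_coboundary {σ : Site → ℝ} (hσ : ∀ z, σ z * σ z = 1) (x y : Site)
    (t : List Site) : pathWeight (fun u v => σ u * σ v) (x :: (t ++ [y])) = σ x * σ y := by
  induction t generalizing x with
  | nil => simp
  | cons z t ih =>
    rw [List.cons_append, pathWeight_cons_cons, ih]
    linear_combination (σ x * σ y) * hσ z

lemma pathWeight_coboundary_closeUp {σ : Site → ℝ} (hσ : ∀ z, σ z * σ z = 1) (l : List Site) :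
    pathWeight (fun u v => σ u * σ v) (closeUp l) = 1 := by
  cases l with
  | nil => rfl
  | cons x t =>
    rw [← hσ x]
    exact pathWeight_coboundary hσ x x t

lemma windingSign_mul_self (l : List Site) (v : Site) : windingSign l v * windingSign l v = 1 := by
  rw [windingSign, ← pathWeight_mul]
  refine pathWeight_eq_one fun e _ => ?_
  simp only [raySign]
  split_ifs <;> norm_num

variable {l : List Site}

/-- The two rays together consist of the horizontal edges at the half-column below `(a + 1, b)`. Its
only other boundary edge ends at `(a + 1, b)`, which the loop avoids, so the product of the signs is
a coboundary. -/
lemma windingSign_right (hl : (closeUp l).IsChain lattice.Adj) {a b : ℤ} (h : (a + 1, b) ∉ l) :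
    windingSign l (a, b) = windingSign l (a + 1, b) := by
  have hprod : windingSign l (a, b) * windingSign l (a + 1, b) = 1 := by
    set σ : Site → ℝ := fun z => if z.1 = a + 1 ∧ z.2 < b then -1 else 1 with hσ
    have hσσ : ∀ z, σ z * σ z = 1 := fun z => by
      simp only [hσ]; split_ifs <;> norm_num
    rw [windingSign, windingSign, ← pathWeight_mul, ← pathWeight_coboundary_closeUp hσσ l]
    refine pathWeight_congr fun e he => ?_
    have hadj := adj_of_mem_steps hl he
    obtain ⟨h1, h2⟩ := mem_of_mem_steps he
    rw [mem_closeUp] at h1 h2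
    obtain ⟨⟨p, q⟩, ⟨p', q'⟩⟩ := e
    have h1' : ¬ (p = a + 1 ∧ q = b) := by rintro ⟨rfl, rfl⟩; exact h h1
    have h2' : ¬ (p' = a + 1 ∧ q' = b) := by rintro ⟨rfl, rfl⟩; exact h h2
    rw [adj_iff_mem_nbrs] at hadj
    simp only [nbrs, mem_insert, mem_singleton, Prod.mk.injEq] at hadj
    simp only [raySign, hσ]
    split_ifs <;> first
      | (exfalso; omega)
      | norm_num
  have := windingSign_mul_self l (a + 1, b)
  linear_combination (windingSign l (a + 1, b)) * hprod - windingSign l (a, b) * this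

/-- The rays differ by a single edge, which has the avoided point `(a, b)` as an end. -/
lemma windingSign_down (hl : (closeUp l).IsChain lattice.Adj) {a b : ℤ} (h : (a, b) ∉ l) :
    windingSign l (a, b + 1) = windingSign l (a, b) := by
  refine pathWeight_congr fun e he => ?_
  have hadj := adj_of_mem_steps hl he
  obtain ⟨h1, h2⟩ := mem_of_mem_steps he
  rw [mem_closeUp] at h1 h2
  obtain ⟨⟨p, q⟩, ⟨p', q'⟩⟩ := e
  have h1' : ¬ (p = a ∧ q = b) := by rintro ⟨rfl, rfl⟩; exact h h1
  have h2' : ¬ (p' = a ∧ q' = b) := by rintro ⟨rfl, rfl⟩; exact h h2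
  simp only [raySign]
  split_ifs <;> first
    | (exfalso; omega)
    | rfl

lemma windingSign_adj (hl : (closeUp l).IsChain lattice.Adj) {u v : Site} (huv : lattice.Adj u v)
    (hu : u ∉ l) (hv : v ∉ l) : windingSign l u = windingSign l v := by
  obtain ⟨a, b⟩ := u
  rw [adj_iff_mem_nbrs] at huv
  simp only [nbrs, mem_insert, mem_singleton] at huv
  rcases huv with rfl | rfl | rfl | rfl
  · exact windingSign_right hl hv
  · have := windingSign_right hl (a := a - 1) (b := b) (by simpa using hu)
    simpa using this.symm
  · exact (windingSign_down hl hu).symm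
  · simpa using windingSign_down hl (a := a) (b := b - 1) hv

lemma windingSign_eq_of_isChain (hl : (closeUp l).IsChain lattice.Adj) {x : Site} {t : List Site}
    (hη : (x :: t).IsChain lattice.Adj) (hd : ∀ z ∈ x :: t, z ∉ l) {z : Site} (hz : z ∈ x :: t) :
    windingSign l z = windingSign l x := by
  induction t generalizing x with
  | nil => rw [List.mem_singleton.1 hz]
  | cons v t ih =>
    rw [List.isChain_cons_cons] at hη
    rcases List.mem_cons.1 hz with rfl | hz
    · rfl
    · rw [ih hη.2 (fun z hz => hd z (List.mem_cons_of_mem _ hz)) hz]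
      exact (windingSign_adj hl hη.1 (hd _ (by simp)) (hd _ (by simp))).symm

lemma exists_forall_lt_snd (A : Finset Site) : ∃ b : ℕ, ∀ z ∈ A, -(b : ℤ) < z.2 := by
  refine ⟨1 + ∑ z ∈ A, z.2.natAbs, fun z hz => ?_⟩
  have := single_le_sum (f := fun z : Site => z.2.natAbs) (fun _ _ => Nat.zero_le _) hz
  omega

/-- The parity is constant on the connected complement of `A`, and it is trivial at a point lying
below all of `A`. -/
lemma windingSign_eq_one_of_notMem (hA : (lattice.induce (A : Set Site)ᶜ).Connected)
    (hl : (closeUp l).IsChain lattice.Adj) (hlA : ∀ z ∈ l, z ∈ A) {x : Site} (hx : x ∉ A) :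
    windingSign l x = 1 := by
  obtain ⟨b, hb⟩ := exists_forall_lt_snd A
  have hfar : ((0, -(b : ℤ)) : Site) ∉ A := fun h => lt_irrefl _ (hb _ h)
  have key : ∀ u v : ((A : Set Site)ᶜ : Set Site), (lattice.induce (A : Set Site)ᶜ).Walk u v →
      windingSign l u = windingSign l v := by
    intro u v p
    induction p with
    | nil => rfl
    | cons h p ih =>
      rename_i u v w
      rw [← ih]
      exact windingSign_adj hl h (fun h' => u.2 (hlA _ h')) (fun h' => v.2 (hlA _ h'))
  obtain ⟨p⟩ := hA.preconnected ⟨x, hx⟩ ⟨(0, -(b : ℤ)), hfar⟩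
  rw [key _ _ p]
  refine pathWeight_eq_one fun e he => ?_
  have h1 := hb _ (hlA _ (mem_closeUp.1 (mem_of_mem_steps he).1))
  simp only [raySign]
  rw [if_neg]
  rintro ⟨-, h2, -⟩
  omega

/-- A loop in `A` that avoids a path from the complement of `A` to the origin crosses the zipper an
even number of times. -/
theorem zipperSign_closeUp_eq_one (hA : (lattice.induce (A : Set Site)ᶜ).Connected)
    (hl : l ∈ rootedLoops A) {x : Site} (hx : x ∉ A) {t : List Site}
    (hη : (x :: t).IsChain lattice.Adj) (h0 : ((0, 0) : Site) ∈ x :: t)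
    (hd : ∀ z ∈ x :: t, z ∉ l) : pathWeight (zipperSign A) (closeUp l) = 1 := by
  classical
  obtain ⟨-, hlA, hch⟩ := hl
  have hex : ∃ j : ℕ, 0 < j ∧ ¬ (((0, -(j : ℤ)) : Site) ∈ A ∧ ((1, -(j : ℤ)) : Site) ∈ A) := by
    obtain ⟨b, hb⟩ := exists_forall_lt_snd A
    refine ⟨b + 1, b.succ_pos, fun h => ?_⟩
    have := hb _ h.1
    push_cast at this
    omega
  obtain ⟨k, ⟨hk0, hk⟩, hmin⟩ : ∃ k : ℕ,
      (0 < k ∧ ¬ (((0, -(k : ℤ)) : Site) ∈ A ∧ ((1, -(k : ℤ)) : Site) ∈ A)) ∧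
      ∀ j < k, 0 < j → ((0, -(j : ℤ)) : Site) ∈ A ∧ ((1, -(j : ℤ)) : Site) ∈ A :=
    ⟨Nat.find hex, Nat.find_spec hex, fun j hj hj0 => by
      have := Nat.find_min hex hj
      tauto⟩
  -- One of the two points at height `-k` is outside `A`; if it is the right one, a move to the
  -- right reaches it.
  have hbottom : windingSign l (0, -(k : ℤ)) = 1 := by
    by_cases h : ((0, -(k : ℤ)) : Site) ∈ A
    · have h1 : ((0 + 1, -(k : ℤ)) : Site) ∉ A := fun h' => hk ⟨h, h'⟩
      rw [windingSign_right hch fun h' => h1 (hlA _ h')]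
      exact windingSign_eq_one_of_notMem hA hch hlA h1
    · exact windingSign_eq_one_of_notMem hA hch hlA h
  have htop : windingSign l (0, 0) = 1 := by
    rw [windingSign_eq_of_isChain hch hη hd h0]
    exact windingSign_eq_one_of_notMem hA hch hlA hx
  -- The ray below the origin consists of the zipper, the edge at height `-k`, and the ray below
  -- `-ki`. The middle edge has an end outside `A`, so the loop does not use it.
  have hprod : pathWeight (zipperSign A) (closeUp l) * windingSign l (0, -(k : ℤ)) =
      windingSign l (0, 0) := by
    unfold windingSign
    rw [← pathWeight_mul]
    refine pathWeight_congr fun e he => ?_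
    obtain ⟨h1, h2⟩ := mem_of_mem_steps he
    replace h1 := hlA _ (mem_closeUp.1 h1)
    replace h2 := hlA _ (mem_closeUp.1 h2)
    obtain ⟨⟨p, q⟩, ⟨p', q'⟩⟩ := e
    simp only at h1 h2
    simp only [zipperSign, raySign]
    by_cases hz : CrossesZipper A (p, q) (p', q')
    · rw [if_pos hz]
      obtain ⟨j, hj0, hj, hjj⟩ := hz
      have hjk : j < k := by
        by_contra! hle
        exact hk (hj k hk0 hle)
      simp only [Prod.mk.injEq] at hjj
      rw [if_neg (by omega), if_pos (by omega)]
      norm_num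
    · rw [if_neg hz, one_mul]
      refine if_congr ⟨fun h => ?_, fun h => ?_⟩ rfl rfl
      · omega
      · refine ⟨h.1, ?_, h.2.2⟩
        by_contra! hle
        obtain ⟨j, rfl⟩ : ∃ j : ℕ, q = -(j : ℤ) := ⟨q.natAbs, by omega⟩
        have hq' : q' = -(j : ℤ) := h.1.symm
        subst hq'
        have hends : ((0, -(j : ℤ)) : Site) ∈ A ∧ ((1, -(j : ℤ)) : Site) ∈ A := by
          rcases h.2.2 with ⟨h3, h4⟩ | ⟨h3, h4⟩
          · simp only [zero_add] at h3 h4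
            subst h3 h4
            exact ⟨h1, h2⟩
          · simp only [zero_add] at h3 h4
            subst h3 h4
            exact ⟨h2, h1⟩
        refine hz ⟨j, by omega, fun i hi0 hij => ?_, ?_⟩
        · rcases (show i ≤ k by omega).lt_or_eq with hik | rfl
          · exact hmin i hik hi0
          · obtain rfl : i = j := by omega
            exact hends
        · simp only [Prod.mk.injEq, and_true]
          have := h.2.2
          omega
  rw [hbottom, htop, mul_one] at hprod
  exact hprod

/-! ### Unrooted loops -/

lemma pathWeight_closeUp_rotate_one (w : Site → Site → ℝ) (l : List Site) :
    pathWeight w (closeUp (l.rotate 1)) = pathWeight w (closeUp l) := by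
  match l with
  | [] => rfl
  | [x] => simp
  | x :: y :: s =>
    have h1 : closeUp ((x :: y :: s).rotate 1) = (y :: (s ++ [x])) ++ [y] := by simp [closeUp]
    have h2 : closeUp (x :: y :: s) = x :: y :: (s ++ [x]) := by simp [closeUp]
    rw [h1, h2, pathWeight_append w (a := y :: (s ++ [x])) (z := x)
      (by rw [← List.cons_append, List.getLast?_append]; rfl), pathWeight_cons_cons,
      pathWeight_cons_cons, pathWeight_singleton]
    ring

lemma pathWeight_closeUp_of_isRotated (w : Site → Site → ℝ) {l l' : List Site} (h : l ~r l') :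
    pathWeight w (closeUp l) = pathWeight w (closeUp l') := by
  obtain ⟨n, rfl⟩ := h
  induction n with
  | zero => simp
  | succ n ih => rw [ih, ← List.rotate_rotate, pathWeight_closeUp_rotate_one]

-- Turns adjacency along a path into a statement about a weight, so that it inherits invariance
-- under rotation of a loop.
open Classical in
lemma isChain_iff_pathWeight_ne_zero (ω : List Site) : ω.IsChain lattice.Adj ↔
    pathWeight (fun u v => if lattice.Adj u v then 1 else 0) ω ≠ 0 := by
  constructor
  · intro h
    rw [pathWeight_eq_one fun e he => if_pos (adj_of_mem_steps h he)]
    exact one_ne_zero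
  · exact not_imp_comm.1 (pathWeight_eq_zero_of_not_isChain fun u v h => if_neg h)

lemma mem_rootedLoops_of_isRotated {l l' : List Site} (h : l ~r l') (hl : l ∈ rootedLoops A) :
    l' ∈ rootedLoops A := by
  obtain ⟨h1, h2, h3⟩ := hl
  refine ⟨?_, fun z hz => h2 z (h.mem_iff.2 hz), ?_⟩
  · rintro rfl
    exact h1 (List.isRotated_nil_iff.1 h)
  · rw [isChain_iff_pathWeight_ne_zero] at h3 ⊢
    rwa [← pathWeight_closeUp_of_isRotated _ h]

lemma odd_crossings_iff (A : Finset Site) (ω : List Site) :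
    Odd (crossings A ω) ↔ pathWeight (zipperSign A) ω = -1 := by
  rw [pathWeight_zipperSign]
  refine ⟨Odd.neg_one_pow, fun h => ?_⟩
  by_contra hne
  rw [(Nat.not_odd_iff_even.1 hne).neg_one_pow] at h
  norm_num at h

/-- A rotation-invariant set of rooted loops is the disjoint union of its rotation classes, each
being the set of distinct representatives of one cycle. Hence rooted and unrooted masses agree. -/
lemma hasSum_cycle {R : Set (List Site)} (hR : ∀ l ∈ R, ∀ l', l ~r l' → l' ∈ R)
    {f : List Site → ℝ} {a : ℝ} (hf : HasSum (R.indicator f) a) :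
    HasSum (fun ℓ : (fun l : List Site => (l : Cycle Site)) '' R =>
      ∑ l ∈ ℓ.1.lists.toFinset, f l) a := by
  have hmem : ∀ p : (Σ ℓ : (fun l : List Site => (l : Cycle Site)) '' R,
      {l // l ∈ ℓ.1.lists.toFinset}), p.2.1 ∈ R := by
    rintro ⟨⟨_, l, hl, rfl⟩, ⟨l', hl'⟩⟩
    rw [Multiset.mem_toFinset, Cycle.mem_lists_iff_coe_eq] at hl'
    exact hR l hl l' (Cycle.coe_eq_coe.1 hl'.symm)
  let e : (Σ ℓ : (fun l : List Site => (l : Cycle Site)) '' R,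
      {l // l ∈ ℓ.1.lists.toFinset}) ≃ R := Equiv.ofBijective (fun p => ⟨p.2.1, hmem p⟩) <| by
    constructor
    · rintro ⟨⟨ℓ, hℓ⟩, ⟨l, hl⟩⟩ ⟨⟨ℓ', hℓ'⟩, ⟨l', hl'⟩⟩ h
      obtain rfl : l = l' := congrArg Subtype.val h
      have h1 := hl
      have h2 := hl'
      rw [Multiset.mem_toFinset, Cycle.mem_lists_iff_coe_eq] at h1 h2
      simp only at h1 h2
      subst h1 h2
      rfl
    · rintro ⟨l, hl⟩
      exact ⟨⟨⟨l, l, hl, rfl⟩, ⟨l, by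
        rw [Multiset.mem_toFinset, Cycle.mem_lists_iff_coe_eq]⟩⟩, rfl⟩
  rw [← hasSum_subtype_iff_indicator, ← e.hasSum_iff] at hf
  exact hf.sigma fun ℓ => Finset.hasSum _ f

lemma indicator_rootedLoops (hw : ∀ u v, |w u v| ≤ srw A u v) (B : Finset Site) (l : List Site) :
    (if ∀ z ∈ l, z ∈ B then pathWeight w (closeUp l) / l.length else 0) =
      (rootedLoops B).indicator (fun l => pathWeight w (closeUp l) / l.length) l := by
  by_cases hl : l ∈ rootedLoops B
  · rw [Set.indicator_of_mem hl, if_pos hl.2.1]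
  · rw [Set.indicator_of_notMem hl]
    split_ifs with h
    · by_cases h0 : l = []
      · simp [h0]
      · rw [pathWeight_eq_zero_of_not_isChain (fun u v => eq_zero_of_not_adj hw)
          fun h' => hl ⟨h0, h, h'⟩, zero_div]
    · rfl

lemma abs_srw_le (A : Finset Site) (u v : Site) : |srw A u v| ≤ srw A u v :=
  (abs_of_nonneg (srw_nonneg A u v)).le

lemma summable_loopMeasure (A : Finset Site) :
    Summable fun ℓ : unrootedLoops A => loopMeasure (srw A) ℓ := by
  have h := (hasSum_rootedLoops subset_rfl (abs_srw_le A) (srw_symm A)).2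
  simp only [indicator_rootedLoops (abs_srw_le A)] at h
  exact (hasSum_cycle (fun l hl l' h => mem_rootedLoops_of_isRotated h hl) h).summable

/-- The exponential of the mass of the odd loops is a ratio of determinants. -/
theorem exp_two_mul_loopMass_oddLoops (A : Finset Site) :
    Real.exp (2 * loopMass (srw A) (oddLoops A)) =
      lapDet (zipperWeight A) A A / lapDet (srw A) A A := by
  obtain ⟨hp0, hp⟩ := hasSum_rootedLoops subset_rfl (abs_srw_le A) (srw_symm A)
  obtain ⟨hq0, hq⟩ :=
    hasSum_rootedLoops subset_rfl (abs_zipperWeight_le A) (zipperWeight_symm A)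
  -- The difference `p(l) - q(l)` is `2 p(l)` on odd loops and 0 on even ones, so the odd mass is
  -- half the difference of the two log-determinant series.
  have hodd : HasSum ({l | l ∈ rootedLoops A ∧ Odd (crossings A (closeUp l))}.indicator
      fun l => pathWeight (srw A) (closeUp l) / l.length)
      ((-Real.log (lapDet (srw A) A A) - -Real.log (lapDet (zipperWeight A) A A)) / 2) := by
    refine (congrArg (HasSum · _) (funext fun l => ?_)).mpr ((hp.sub hq).div_const 2)
    rw [indicator_rootedLoops (abs_srw_le A), indicator_rootedLoops (abs_zipperWeight_le A)]
    by_cases hl : l ∈ rootedLoops A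
    · rw [Set.indicator_of_mem hl, Set.indicator_of_mem hl, pathWeight_zipperWeight,
        pathWeight_zipperSign]
      by_cases ho : Odd (crossings A (closeUp l))
      · rw [Set.indicator_of_mem (by exact ⟨hl, ho⟩), ho.neg_one_pow]
        ring
      · rw [Set.indicator_of_notMem (fun h => ho h.2), (Nat.not_odd_iff_even.1 ho).neg_one_pow]
        ring
    · rw [Set.indicator_of_notMem hl, Set.indicator_of_notMem hl,
        Set.indicator_of_notMem (fun h => hl h.1)]
      ring
  have hmass : loopMass (srw A) (oddLoops A) =
      (-Real.log (lapDet (srw A) A A) - -Real.log (lapDet (zipperWeight A) A A)) / 2 := by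
    refine (hasSum_cycle (R := {l | l ∈ rootedLoops A ∧ Odd (crossings A (closeUp l))})
      (fun l hl l' h => ⟨mem_rootedLoops_of_isRotated h hl.1, ?_⟩) hodd).tsum_eq
    have := hl.2
    rwa [odd_crossings_iff, pathWeight_closeUp_of_isRotated _ h, ← odd_crossings_iff] at this
  rw [hmass, show 2 * ((-Real.log (lapDet (srw A) A A) -
    -Real.log (lapDet (zipperWeight A) A A)) / 2) = Real.log (lapDet (zipperWeight A) A A) -
    Real.log (lapDet (srw A) A A) by ring, Real.exp_sub, Real.exp_log hp0, Real.exp_log hq0]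

lemma lapDet_zipperWeight_eq (hB : B ⊆ A)
    (h : ∀ l ∈ rootedLoops B, pathWeight (zipperSign A) (closeUp l) = 1) :
    lapDet (zipperWeight A) A B = lapDet (srw A) A B := by
  obtain ⟨hp0, hp⟩ := hasSum_rootedLoops hB (abs_srw_le A) (srw_symm A)
  obtain ⟨hq0, hq⟩ := hasSum_rootedLoops hB (abs_zipperWeight_le A) (zipperWeight_symm A)
  simp only [indicator_rootedLoops (abs_srw_le A)] at hp
  simp only [indicator_rootedLoops (abs_zipperWeight_le A)] at hq
  have : (rootedLoops B).indicator (fun l => pathWeight (srw A) (closeUp l) / l.length) =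
      (rootedLoops B).indicator fun l => pathWeight (zipperWeight A) (closeUp l) / l.length := by
    refine Set.indicator_congr fun l hl => ?_
    rw [pathWeight_zipperWeight, h l hl, one_mul]
  rw [← this] at hq
  exact Real.log_injOn_pos hq0 hp0 (neg_injective (hq.unique hp))

/-! ### Comparison of the two loop-erased measures -/

/-- Loops in `A \ η` avoid `η`, which leads from `x ∉ A` to the origin, so the determinants on `A \
η` agree. What remains is the sign of `η` and the ratio of determinants on `A`. -/
theorem loopErasedMeasure_zipperWeight (hA : (lattice.induce (A : Set Site)ᶜ).Connected)
    {x y : Site} (hx : x ∉ A) (hy : y ∉ A) (hxy : x ≠ y) {η : List Site} (hη : η ∈ saws A x y)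
    (h0 : ((0, 0) : Site) ∈ η) :
    loopErasedMeasure (srw A) A x y η = Real.exp (2 * loopMass (srw A) (oddLoops A)) *
      ((-1) ^ crossings A η * loopErasedMeasure (zipperWeight A) A x y η) := by
  have hp := loopErasedMeasure_mul_lapDet subset_rfl (abs_srw_le A) hx hy hxy hη
  have hq := loopErasedMeasure_mul_lapDet subset_rfl (abs_zipperWeight_le A) hx hy hxy hη
  have hp0 := (hasSum_rootedLoops (A := A) subset_rfl (abs_srw_le A) (srw_symm A)).1
  have hdet : lapDet (zipperWeight A) A (A \ η.toFinset) = lapDet (srw A) A (A \ η.toFinset) := by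
    refine lapDet_zipperWeight_eq sdiff_subset fun l hl => ?_
    obtain ⟨t, rfl⟩ := exists_cons_of_mem_walks hη.1
    refine zipperSign_closeUp_eq_one hA
      ⟨hl.1, fun z hz => (mem_sdiff.1 (hl.2.1 z hz)).1, hl.2.2⟩ hx hη.1.2.2.1 h0 fun z hz hzl => ?_
    exact (mem_sdiff.1 (hl.2.1 z hzl)).2 (List.mem_toFinset.2 hz)
  rw [hdet, pathWeight_zipperWeight, pathWeight_zipperSign, mul_assoc, ← hp] at hq
  have hsq : ((-1 : ℝ) ^ crossings A η) * (-1) ^ crossings A η = 1 := by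
    rw [← mul_pow]; norm_num
  rw [exp_two_mul_loopMass_oddLoops, eq_comm, div_mul_eq_mul_div, div_eq_iff hp0.ne']
  linear_combination (-1 : ℝ) ^ crossings A η * hq +
    loopErasedMeasure (srw A) A x y η * lapDet (srw A) A A * hsq

lemma expect_eq_tsum_loopErasedMeasure (hB : B ⊆ A) (hw : ∀ u v, |w u v| ≤ srw A u v)
    (x y : Site) {X : List Site → ℝ} (hX : ∀ η, |X η| ≤ 1) :
    (expect w B x y fun ω => X (loopErase ω)) = ∑' η, X η * loopErasedMeasure w B x y η := by
  have h := (summable_mul_pathWeight hB hw x y (F := fun ω => X (loopErase ω))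
    fun _ => hX _).hasSum.tsum_fiberwise fun ω => loopErase ω.1
  refine h.tsum_eq.symm.trans (tsum_congr fun η => ?_)
  rw [loopErasedMeasure_eq_expect, expect, ← tsum_mul_left]
  refine (tsum_subtype ((fun ω : walks B x y => loopErase ω.1) ⁻¹' {η})
    fun ω => X (loopErase ω.1) * pathWeight w ω).trans (tsum_congr fun ω => ?_)
  by_cases h : loopErase ω.1 = η <;> simp [Set.indicator, h]

lemma loopErasedMeasure_eq_zero {x y : Site} {η : List Site} (h : η ∉ saws B x y) :
    loopErasedMeasure w B x y η = 0 := by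
  have : IsEmpty {ω : List Site // ω ∈ walks B x y ∧ loopErase ω = η} :=
    ⟨fun ω => h (ω.2.2 ▸ loopErase_mem_saws ω.2.1)⟩
  exact tsum_empty

theorem expect_usesUndirected (hA : (lattice.induce (A : Set Site)ᶜ).Connected)
    {x y : Site} (hx : x ∉ A) (hy : y ∉ A) (hxy : PositivelyOrdered A x y) :
    expect (srw A) A x y (usesUndirected ((0, 0), (1, 0))) =
      Real.exp (2 * loopMass (srw A) (oddLoops A)) *
        expect (zipperWeight A) A x y (fun ω =>
          usesDirected ((0, 0), (1, 0)) ω - usesDirected ((1, 0), (0, 0)) ω) := by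
  set e : Site × Site := ((0, 0), (1, 0)) with he
  set e' : Site × Site := ((1, 0), (0, 0)) with he'
  have hp := expect_eq_tsum_loopErasedMeasure (subset_refl A) (abs_srw_le A) x y
    (X := fun η => if e ∈ steps η ∨ e' ∈ steps η then 1 else 0) fun η => by split_ifs <;> simp
  have hq := expect_eq_tsum_loopErasedMeasure (subset_refl A) (abs_zipperWeight_le A) x y
    (X := fun η => (if e ∈ steps η then 1 else 0) - (if e' ∈ steps η then 1 else 0))
    fun η => by split_ifs <;> simp
  refine hp.trans (Eq.trans ?_ (congrArg _ hq.symm))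
  rw [← tsum_mul_left]
  refine tsum_congr fun η => ?_
  by_cases hη : η ∈ saws A x y
  · by_cases h1 : e ∈ steps η
    · have hev := hxy.2.1 η hη h1
      -- The two parity conditions exclude each other, so no self-avoiding walk is counted for both
      -- directions.
      have h2 : e' ∉ steps η := fun h2 =>
        Nat.not_odd_iff_even.2 hev (hxy.2.2 η hη h2)
      rw [if_pos (.inl h1), if_pos h1, if_neg h2,
        loopErasedMeasure_zipperWeight hA hx hy hxy.1 hη (mem_of_mem_steps h1).1,
        hev.neg_one_pow]
      ring
    · by_cases h2 : e' ∈ steps η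
      · have hodd := hxy.2.2 η hη h2
        rw [if_pos (.inr h2), if_neg h1, if_pos h2,
          loopErasedMeasure_zipperWeight hA hx hy hxy.1 hη (mem_of_mem_steps h2).2,
          hodd.neg_one_pow]
        ring
      · rw [if_neg (by tauto), if_neg h1, if_neg h2]
        ring
  · rw [loopErasedMeasure_eq_zero hη, loopErasedMeasure_eq_zero hη]
    ring

end LoopErased

open LoopErased in
theorem mainTheorem11 (A : Finset Site) (hA : IsSimplyConnectedSet A) (x y : Site)
    (hx : x ∈ boundary A) (hy : y ∈ boundary A) (hxy : PositivelyOrdered A x y) :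
    -- all the series below converge absolutely
    (∀ B ⊆ A, ∀ u v : Site,
      Summable (fun ω : walks B u v => pathWeight (srw A) ω) ∧
      Summable (fun ω : walks B u v => pathWeight (zipperWeight A) ω)) ∧
    Summable (fun ℓ : unrootedLoops A => loopMeasure (srw A) ℓ) ∧
    -- self-avoiding walks through the directed edge from 0 to 1
    (∀ η ∈ saws A x y, (((0, 0), (1, 0)) : Site × Site) ∈ steps η →
      loopErasedMeasure (zipperWeight A) A x y η =
        loopErasedMeasure (srw A) A x y η * Real.exp (-2 * loopMass (srw A) (oddLoops A))) ∧
    -- loop-erased walks through the undirected edge joining 0 and 1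
    expect (srw A) A x y (usesUndirected ((0, 0), (1, 0))) =
      Real.exp (2 * loopMass (srw A) (oddLoops A)) *
        expect (zipperWeight A) A x y (fun ω =>
          usesDirected ((0, 0), (1, 0)) ω - usesDirected ((1, 0), (0, 0)) ω) ∧
    expect (srw A) A x y (usesUndirected ((0, 0), (1, 0))) =
      Real.exp (2 * loopMass (srw A) (oddLoops A)) *
        (zipperWeight A (0, 0) (1, 0) * loopFactor (zipperWeight A) [(0, 0), (1, 0)] A *
          kernelDet (zipperWeight A) (A \ {(0, 0), (1, 0)}) x y (0, 0) (1, 0)) := by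
  have hx' : x ∉ A := hx.1
  have hy' : y ∉ A := hy.1
  have hund := expect_usesUndirected hA.compl_connected hx' hy' hxy
  refine ⟨fun B hB u v => ⟨summable_pathWeight_srw hB u v, ?_⟩, summable_loopMeasure A,
    fun η hη hs => ?_, hund, ?_⟩
  · simpa using summable_mul_pathWeight hB (abs_zipperWeight_le A) u v (F := fun _ => 1) (by simp)
  · rw [loopErasedMeasure_zipperWeight hA.compl_connected hx' hy' hxy.1 hη
      (mem_of_mem_steps hs).1, (hxy.2.1 η hη hs).neg_one_pow, one_mul, mul_right_comm,
      ← Real.exp_add]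
    simp
  · rw [hund, expect_usesDirected_sub_eq_kernelDet (abs_zipperWeight_le A) (zipperWeight_symm A)
      (by simp) hA.zero_mem hA.one_mem hx' hy' hxy.1]
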